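/- For $p\in\mathbb C$ with $|p|<1$ and $z\in\mathbb C\setminus\{0\}$ let $\theta(z;p)=\prod_{j=0}^{\infty}(1-zp^j)(1-p^{j+1}/z)$, and for integers $n\ge 0$ let $(a;q,p)_n=\prod_{j=0}^{n-1}\theta(aq^j;p)$ and, as usual, $(a;q,p)_{-n}=1/(aq^{-n};q,p)_n$. A pair of sequences $(\alpha_n)_{n\ge0},(\beta_n)_{n\ge0}$ of complex numbers is an elliptic WP Bailey pair at $(a,k;q,p)$ if for all $n\ge 0$ $$\beta_n=\sum_{r=0}^n\frac{(k/a;q,p)_{n-r}}{(q;q,p)_{n-r}}\frac{(k;q,p)_{n+r}}{(aq;q,p)_{n+r}}\,\alpha_r .$$ For a positive integer $i$, a pair of sequences $(A^{(i)}_n)_{n\ge0},(B^{(i)}_n)_{n\ge0}$ is a bibasic elliptic WP Bailey pair of order $i$ at $(a,k;q,p)$ (cubic if $i=3$) if for all $n\ge 0$ $$B^{(i)}_n=\sum_{r=0}^n\frac{(k/a;q,p)_{n-ir}}{(q^i;q^i,p)_{n-r}}\frac{(k;q,p)_{n+ir}}{(aq^i;q^i,p)_{n+r}}\,A^{(i)}_r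 .$$ Theorem. Let $a,k,m,q,p\in\mathbb C$ with $a,m,q\neq0$, $|p|<1$ and $m^3=ak$, and suppose that no denominator below vanishes, i.e. $\theta(q^{3j};p)$, $\theta(aq^{3j};p)$, $\theta(mq^{-j}/a;p)$ are nonzero for all $j\ge1$ and $\theta(mq^j;p)$, $\theta(m^2q^j/a;p)$ are nonzero for all $j\ge0$. Let $(A^{(3)},B^{(3)})$ be a cubic bibasic elliptic WP Bailey pair at $(a,m;q,p)$. Then the sequences \begin{align*} \alpha_n&=q^{3n^2}a^n A^{(3)}_n,\\ \beta_n&=\sum_{r=0}^n\frac{\theta(mq^{4r};p)}{\theta(m;p)}\frac{(aq/m;q,p)_{2r}}{(m^2/a;q,p)_{2r}}\frac{(k/m;q,p)_{3n-r}}{(q^3;q^3,p)_{n-r}}\frac{(k;q^3,p)_{n+r}}{(mq;q,p)_{3n+r}}\,q^{2\binom r2}\Bigl(\frac km\Bigr)^r B^{(3)}_r \end{align*} form an elliptic WP Bailey pair at $(a,k;q^3,p)$. -/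

import Mathlib

open Finset BigOperators

noncomputable section

/-- The modified Jacobi theta function `θ(z;p) = ∏_{j ≥ 0} (1 - z p^j) (1 - p^(j+1) / z)`,
for `‖p‖ < 1` and `z ≠ 0`. -/
def ellTheta (z p : ℂ) : ℂ :=
  ∏' j : ℕ, (1 - z * p ^ j) * (1 - p ^ (j + 1) / z)

/-- The elliptic `q`-shifted factorial `(a;q,p)_n`, for an integer index `n`:
`(a;q,p)_n = ∏_{j=0}^{n-1} θ(a q^j;p)` for `n ≥ 0`, and
`(a;q,p)_{-n} = 1 / (a q^{-n};q,p)_n = 1 / ∏_{j=1}^{n} θ(a q^{-j};p)` for `n ≥ 1`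
(the extension for which `(a;q,p)_{n+l} = (a;q,p)_n (a q^n;q,p)_l` for all integers). -/
def ellFac (a q p : ℂ) : ℤ → ℂ
  | Int.ofNat n => ∏ j ∈ range n, ellTheta (a * q ^ j) p
  | Int.negSucc n => (∏ j ∈ range (n + 1), ellTheta (a / q ^ (j + 1)) p)⁻¹

/-- `(α, β)` is an elliptic well-poised Bailey pair with respect to `(a,k;q,p)`. -/
def IsEllipticWPBaileyPair (a k q p : ℂ) (α β : ℕ → ℂ) : Prop :=
  ∀ n : ℕ, β n = ∑ r ∈ range (n + 1),
    ellFac (k / a) q p ((n : ℤ) - r) / ellFac q q p ((n : ℤ) - r) *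
    (ellFac k q p ((n : ℤ) + r) / ellFac (a * q) q p ((n : ℤ) + r)) * α r

/-- `(A, B)` is a bibasic elliptic well-poised Bailey pair of order `i`
with respect to `(a,k;q,p)`. -/
def IsBibasicEllipticWPBaileyPair (i : ℕ) (a k q p : ℂ) (A B : ℕ → ℂ) : Prop :=
  ∀ n : ℕ, B n = ∑ r ∈ range (n + 1),
    ellFac (k / a) q p ((n : ℤ) - i * r) / ellFac (q ^ i) (q ^ i) p ((n : ℤ) - r) *
    (ellFac k q p ((n : ℤ) + i * r) / ellFac (a * q ^ i) (q ^ i) p ((n : ℤ) + r)) * A r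

end

/-! Put `b = m / a`, so that `a = m / b` and `k = m ^ 2 * b`. Inserting the cubic pair relation for
`B r` into `β n` and interchanging the sums, the coefficient of `A s` is a single sum over `r`, and
it has to equal the kernel at `(a, k; q ^ 3, p)` times `q ^ (3 * s ^ 2) * a ^ s`. Writing `r = s +
i` and replacing `m, b` by `m * q ^ (4 * s), b / q ^ (2 * s)` reduces this to the case `s = 0`
(`cubicCoeff_eq`), which is the cubic elliptic summation `cubic_sum`.

The cubic summation rests on the observation that its summand contains the value of a Frenkel–Turaev
sum in base `q ^ 3`: with parameters `m * q ^ r`, `m * q ^ (r + 1)`, `m * q ^ (r + 2)`, the products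
in base `q ^ 3` combine in threes into products in base `q` (`cubicTerm_eq`). Expanding that value
as a sum over `l ≤ r` and interchanging, the inner sum over `r = l + i` is zero for `l < n` by
`cubic_orthogonality`; only `l = n` survives and gives the right-hand side. This needs generic `b`.
The exceptional `b` form a countable set, and density and continuity give the rest.

Both tools come from the addition formula `ellTheta_addition`. It makes the orthogonality sum
telescope, and it gives sums and values in `frenkel_turaev` the same recurrence in `n`. The addition
formula itself is a Plücker relation: by the Jacobi triple product, `θ(xy) θ(x/y)` is a double
series which, split by the parity of the sum of its indices, becomes `x * (f x * g y - g x * f y)`.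
-/

section

open Filter Topology

/-! ### The theta product -/

/-- The `j`-th factor of the theta product is `1 + thetaTerm z p j`. -/
noncomputable def thetaTerm (z p : ℂ) (j : ℕ) : ℂ := -(z * p ^ j) - p ^ (j + 1) / z + z * p ^ j * (p ^ (j + 1) / z)

theorem ellTheta_eq_tprod_one_add (z p : ℂ) : ellTheta z p = ∏' j : ℕ, (1 + thetaTerm z p j) := by
  unfold ellTheta thetaTerm
  congr 1; ext j; ring

theorem norm_thetaTerm_le {p : ℂ} (hp : ‖p‖ < 1) (z : ℂ) (j : ℕ) :
    ‖thetaTerm z p j‖ ≤ (‖z‖ + ‖z‖⁻¹ + ‖z‖ * ‖z‖⁻¹) * ‖p‖ ^ j := by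
  have h0 : 0 ≤ ‖p‖ ^ j := by positivity
  have h1 : ‖p‖ ^ (j + 1) ≤ ‖p‖ ^ j := pow_le_pow_of_le_one (norm_nonneg _) hp.le (Nat.le_succ j)
  have h2 : ‖p‖ ^ j ≤ 1 := pow_le_one₀ (norm_nonneg _) hp.le
  have h3 : 0 ≤ ‖z‖⁻¹ := by positivity
  have h4 : 0 ≤ ‖p‖ ^ (j + 1) := by positivity
  have a1 : ‖z * p ^ j‖ = ‖z‖ * ‖p‖ ^ j := by rw [norm_mul, norm_pow]
  have a2 : ‖p ^ (j + 1) / z‖ ≤ ‖z‖⁻¹ * ‖p‖ ^ j := by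
    rw [norm_div, norm_pow, div_eq_mul_inv, mul_comm]
    gcongr
  have a3 : ‖z * p ^ j * (p ^ (j + 1) / z)‖ ≤ ‖z‖ * ‖z‖⁻¹ * ‖p‖ ^ j := by
    rw [norm_mul, a1]
    calc ‖z‖ * ‖p‖ ^ j * ‖p ^ (j + 1) / z‖ ≤ ‖z‖ * 1 * (‖z‖⁻¹ * ‖p‖ ^ j) := by gcongr
      _ = _ := by ring
  calc ‖thetaTerm z p j‖ ≤ ‖-(z * p ^ j) - p ^ (j + 1) / z‖ + ‖z * p ^ j * (p ^ (j + 1) / z)‖ :=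
        norm_add_le _ _
    _ ≤ ‖-(z * p ^ j)‖ + ‖p ^ (j + 1) / z‖ + ‖z * p ^ j * (p ^ (j + 1) / z)‖ := by
        gcongr; exact norm_sub_le _ _
    _ ≤ ‖z‖ * ‖p‖ ^ j + ‖z‖⁻¹ * ‖p‖ ^ j + ‖z‖ * ‖z‖⁻¹ * ‖p‖ ^ j := by
        rw [norm_neg, a1]; gcongr
    _ = _ := by ring

theorem summable_norm_thetaTerm {p : ℂ} (hp : ‖p‖ < 1) (z : ℂ) :
    Summable fun j => ‖thetaTerm z p j‖ :=
  Summable.of_nonneg_of_le (fun _ => norm_nonneg _) (norm_thetaTerm_le hp z)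
    ((summable_geometric_of_lt_one (norm_nonneg _) hp).mul_left _)

theorem tendsto_prod_ellTheta {p : ℂ} (hp : ‖p‖ < 1) (z : ℂ) :
    Tendsto (fun n => ∏ j ∈ range n, ((1 - z * p ^ j) * (1 - p ^ (j + 1) / z))) atTop
      (𝓝 (ellTheta z p)) := by
  have h := (multipliable_one_add_of_summable (summable_norm_thetaTerm hp z)).tendsto_prod_tprod_nat
  rw [← ellTheta_eq_tprod_one_add] at h
  refine h.congr fun n => prod_congr rfl fun j _ => ?_
  unfold thetaTerm; ring

theorem ellTheta_ne_zero_of_forall {p : ℂ} (hp : ‖p‖ < 1) {z : ℂ}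
    (h : ∀ j : ℕ, z * p ^ j ≠ 1 ∧ p ^ (j + 1) ≠ z) (hz : z ≠ 0) : ellTheta z p ≠ 0 := by
  rw [ellTheta_eq_tprod_one_add]
  refine tprod_one_add_ne_zero_of_summable (fun j => ?_) (summable_norm_thetaTerm hp z)
  have : 1 + thetaTerm z p j = (1 - z * p ^ j) * (1 - p ^ (j + 1) / z) := by
    unfold thetaTerm; ring
  rw [this]
  refine mul_ne_zero (sub_ne_zero.2 (h j).1.symm) (sub_ne_zero.2 fun h' => (h j).2 ?_)
  rw [eq_div_iff hz, one_mul] at h'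
  exact h'.symm

theorem countable_ellTheta_zeros {p : ℂ} (hp : ‖p‖ < 1) :
    {z : ℂ | z ≠ 0 ∧ ellTheta z p = 0}.Countable := by
  refine ((Set.countable_range fun j : ℕ => (p ^ j)⁻¹).union
    (Set.countable_range fun j : ℕ => p ^ (j + 1))).mono ?_
  rintro z ⟨hz, h⟩
  by_contra hc
  refine ellTheta_ne_zero_of_forall hp (fun j => ⟨fun h1 => hc (Or.inl ⟨j, ?_⟩),
    fun h2 => hc (Or.inr ⟨j, h2⟩)⟩) hz h
  exact (eq_inv_of_mul_eq_one_left h1).symm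

theorem continuousAt_ellTheta {p : ℂ} (hp : ‖p‖ < 1) {z : ℂ} (hz : z ≠ 0) :
    ContinuousAt (fun w => ellTheta w p) z := by
  simp only [ellTheta_eq_tprod_one_add]
  have hc : ContinuousAt (fun w : ℂ => ‖w‖ + ‖w‖⁻¹ + ‖w‖ * ‖w‖⁻¹) z := by
    have : ‖z‖ ≠ 0 := by simpa using hz
    fun_prop (disch := assumption)
  refine tendsto_tprod_one_add_of_dominated_convergence
    -- The constant in `norm_thetaTerm_le` is continuous at `z ≠ 0`, so near `z` it stays below its
    -- value there plus one; this yields a bound uniform in `w`.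
    (bound := fun j => (‖z‖ + ‖z‖⁻¹ + ‖z‖ * ‖z‖⁻¹ + 1) * ‖p‖ ^ j)
    ((summable_geometric_of_lt_one (norm_nonneg _) hp).mul_left _) (fun j => ?_) ?_
  · have : ContinuousAt (fun w => thetaTerm w p j) z := by
      unfold thetaTerm; fun_prop (disch := assumption)
    exact this
  · have := hc.eventually (gt_mem_nhds (lt_add_one _))
    filter_upwards [this] with w hw j
    refine (norm_thetaTerm_le hp w j).trans ?_
    gcongr

/-- This zero kills the boundary terms in the recurrence and telescoping arguments below. -/
theorem ellTheta_one (p : ℂ) : ellTheta 1 p = 0 := by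
  unfold ellTheta
  exact tprod_of_exists_eq_zero ⟨0, by simp⟩

theorem ellTheta_zero_nome (z : ℂ) : ellTheta z 0 = 1 - z := by
  unfold ellTheta
  rw [tprod_eq_mulSingle 0]
  · simp
  · intro j hj; simp [hj]

/-! ### The triple product identity -/

/-- The exponent `k (k - 1) / 2`. -/
def triExp (k : ℤ) : ℤ := k * (k - 1) / 2

theorem two_mul_triExp (k : ℤ) : 2 * triExp k = k * (k - 1) := by
  unfold triExp
  exact Int.mul_ediv_cancel' (by rcases Int.even_or_odd' k with ⟨c, rfl | rfl⟩ <;>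
    [exact ⟨c * (2 * c - 1), by ring⟩; exact ⟨(2 * c + 1) * c, by ring⟩])

theorem triExp_succ (k : ℤ) : triExp (k + 1) = triExp k + k := by
  have h1 := two_mul_triExp k
  have h2 := two_mul_triExp (k + 1)
  nlinarith

/-- The general term of the theta series. -/
noncomputable def thetaCoeff (z p : ℂ) (k : ℤ) : ℂ := (-1) ^ k * p ^ triExp k * z ^ k

theorem thetaCoeff_succ {z p : ℂ} (hz : z ≠ 0) (hp : p ≠ 0) (k : ℤ) :
    thetaCoeff z p (k + 1) = -(p ^ k * z) * thetaCoeff z p k := by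
  unfold thetaCoeff
  rw [triExp_succ, zpow_add₀ hp, zpow_add_one₀ hz, zpow_add_one₀ (by norm_num : (-1 : ℂ) ≠ 0)]
  ring

theorem thetaCoeff_ne_zero {z p : ℂ} (hz : z ≠ 0) (hp : p ≠ 0) (k : ℤ) : thetaCoeff z p k ≠ 0 := by
  unfold thetaCoeff
  have : (-1 : ℂ) ≠ 0 := by norm_num
  exact mul_ne_zero (mul_ne_zero (zpow_ne_zero _ this) (zpow_ne_zero _ hp)) (zpow_ne_zero _ hz)

/-- Ratio test in both directions: the successive ratios are `-(p ^ n * z)` and `-(p ^ (n + 1) /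
z)`, which tend to `0`. -/
theorem summable_thetaCoeff {z p : ℂ} (hz : z ≠ 0) (hp : p ≠ 0) (hp1 : ‖p‖ < 1) :
    Summable (thetaCoeff z p) := by
  have hpn : Tendsto (fun n : ℕ => p ^ n) atTop (𝓝 0) := tendsto_pow_atTop_nhds_zero_of_norm_lt_one hp1
  refine Summable.of_nat_of_neg ?_ ?_
  · refine summable_of_ratio_test_tendsto_lt_one (l := 0) one_pos
      (Eventually.of_forall fun n => thetaCoeff_ne_zero hz hp _) ?_
    have : Tendsto (fun n : ℕ => ‖-(p ^ n * z)‖) atTop (𝓝 ‖-(0 * z)‖) :=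
      ((hpn.mul_const z).neg).norm
    simp only [zero_mul, neg_zero, norm_zero] at this
    refine this.congr fun n => ?_
    have h0 := thetaCoeff_ne_zero hz hp n
    rw [← norm_div]
    push_cast
    rw [thetaCoeff_succ hz hp, mul_div_assoc, div_self h0, mul_one, zpow_natCast]
  · refine summable_of_ratio_test_tendsto_lt_one (l := 0) one_pos
      (Eventually.of_forall fun n => thetaCoeff_ne_zero hz hp _) ?_
    have : Tendsto (fun n : ℕ => ‖-(p ^ n * p / z)‖) atTop (𝓝 ‖-(0 * p / z)‖) :=
      (((hpn.mul_const p).div_const z).neg).norm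
    simp only [zero_mul, zero_div, neg_zero, norm_zero] at this
    refine this.congr fun n => ?_
    have h0 := thetaCoeff_ne_zero hz hp (-((n + 1 : ℕ) : ℤ))
    have h1 := thetaCoeff_succ hz hp (-((n + 1 : ℕ) : ℤ))
    rw [show -((n + 1 : ℕ) : ℤ) + 1 = -(n : ℤ) by push_cast; ring] at h1
    rw [← norm_div, h1, zpow_neg, zpow_natCast]
    congr 1
    have := pow_ne_zero (n + 1) hp
    field_simp
    ring

theorem one_sub_pow_ne_zero {p : ℂ} (hp : ‖p‖ < 1) (j : ℕ) : 1 - p ^ (j + 1) ≠ 0 := by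
  intro h
  have : ‖p ^ (j + 1)‖ = 1 := by rw [← sub_eq_zero.1 h, norm_one]
  rw [norm_pow] at this
  exact (pow_lt_one₀ (norm_nonneg _) hp (Nat.succ_ne_zero j)).ne this

/-- `1 / (p;p)_m`, extended by zero to negative `m`. -/
noncomputable def invEuler (p : ℂ) : ℤ → ℂ
  | Int.ofNat n => (∏ j ∈ range n, (1 - p ^ (j + 1)))⁻¹
  | Int.negSucc _ => 0

/-- The zero extension is consistent with this recurrence because `1 - p ^ 0 = 0`. It then holds for
every integer, so finite sums can be handled as sums over `ℤ` with free index shifts. -/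
theorem invEuler_pred {p : ℂ} (hp : ‖p‖ < 1) (m : ℤ) :
    invEuler p (m - 1) = (1 - p ^ m) * invEuler p m := by
  rcases m with (_ | n) | n
  · have : Int.ofNat 0 - 1 = Int.negSucc 0 := rfl
    rw [this]
    simp [invEuler]
  · rw [show (Int.ofNat (n + 1) : ℤ) - 1 = Int.ofNat n by simp]
    have := one_sub_pow_ne_zero hp n
    simp only [invEuler, prod_range_succ, Int.ofNat_eq_natCast, zpow_natCast]
    rw [mul_inv]; field_simp
  · rw [show Int.negSucc n - 1 = Int.negSucc (n + 1) by
      simp only [Int.negSucc_eq]; push_cast; ring]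
    simp [invEuler]

theorem HasSum.of_eq {ι : Type*} {f g : ι → ℂ} {a b : ℂ} (h : HasSum g b) (hf : ∀ i, f i = g i)
    (hab : a = b) : HasSum f a := by
  rw [hab, funext hf]; exact h

theorem hasSum_finite_triple_product {z p : ℂ} (hz : z ≠ 0) (hp0 : p ≠ 0) (hp : ‖p‖ < 1) (n : ℕ) :
    HasSum (fun k : ℤ => thetaCoeff z p k * (invEuler p (n - k) * invEuler p (n + k)))
      (invEuler p (2 * n) * ∏ j ∈ range n, ((1 - z * p ^ j) * (1 - p ^ (j + 1) / z))) := by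
  induction n with
  | zero =>
    have : (invEuler p (2 * ((0 : ℕ) : ℤ)) *
        ∏ j ∈ range 0, ((1 - z * p ^ j) * (1 - p ^ (j + 1) / z))) =
        thetaCoeff z p 0 * (invEuler p (((0 : ℕ) : ℤ) - 0) * invEuler p (((0 : ℕ) : ℤ) + 0)) := by
      simp [invEuler, thetaCoeff, triExp]
    rw [this]
    refine hasSum_single 0 fun k hk => ?_
    rcases lt_or_gt_of_ne hk with h | h
    · have : ((0 : ℕ) : ℤ) + k = Int.negSucc (-k - 1).toNat := by
        rw [Int.negSucc_eq]; omega
      rw [this]; simp [invEuler]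
    · have : ((0 : ℕ) : ℤ) - k = Int.negSucc (k - 1).toNat := by
        rw [Int.negSucc_eq]; omega
      rw [this]; simp [invEuler]
  | succ n ih =>
    have e1 : invEuler p (2 * n) =
        (1 - p ^ (2 * n + 1)) * (1 - p ^ (2 * n + 2)) * invEuler p (2 * ((n + 1 : ℕ) : ℤ)) := by
      have h1 := invEuler_pred hp (2 * ((n + 1 : ℕ) : ℤ))
      have h2 := invEuler_pred hp (2 * ((n + 1 : ℕ) : ℤ) - 1)
      rw [h1] at h2
      rw [show 2 * ((n + 1 : ℕ) : ℤ) - 1 - 1 = 2 * n by push_cast; ring,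
        show 2 * ((n + 1 : ℕ) : ℤ) - 1 = ((2 * n + 1 : ℕ) : ℤ) by push_cast; ring,
        show p ^ (2 * ((n + 1 : ℕ) : ℤ)) = p ^ (2 * n + 2) by
          rw [← zpow_natCast]; congr 1] at h2
      rw [h2, zpow_natCast]; ring
    have n1 := one_sub_pow_ne_zero hp (2 * n)
    have n2 := one_sub_pow_ne_zero hp (2 * n + 1)
    -- The new factor is `(1 - z p^n)(1 - p^(n+1)/z) = 1 + p^(2n+1) - z p^n - p^(n+1)/z`; the last
    -- two terms shift the summation index by one down and one up.
    have hm := ((Equiv.subRight (1 : ℤ)).hasSum_iff.2 ih)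
    have hq := ((Equiv.addRight (1 : ℤ)).hasSum_iff.2 ih)
    have H := (((ih.mul_left (1 + p ^ (2 * n + 1))).sub (hm.mul_left (z * p ^ n))).sub
      (hq.mul_left (p ^ (n + 1) / z))).mul_left (((1 - p ^ (2 * n + 1)) * (1 - p ^ (2 * n + 2)))⁻¹)
    refine H.of_eq (fun k => ?_) ?_
    · simp only [Function.comp, Equiv.subRight_apply, Equiv.coe_addRight]
      have w1 : thetaCoeff z p (k - 1) = - p * thetaCoeff z p k / (p ^ k * z) := by
        have h := thetaCoeff_succ hz hp0 (k - 1)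
        rw [sub_add_cancel, zpow_sub_one₀ hp0] at h
        have := zpow_ne_zero k hp0
        rw [h]; field_simp
      rw [w1, thetaCoeff_succ hz hp0]
      have u1 : invEuler p (n - k) =
          (1 - p ^ ((n : ℤ) + 1 - k)) * invEuler p (((n + 1 : ℕ) : ℤ) - k) := by
        rw [show ((n : ℤ) + 1 - k) = ((n + 1 : ℕ) : ℤ) - k by push_cast; ring, ← invEuler_pred hp]
        congr 1; push_cast; ring
      have u2 : invEuler p (n - (k + 1)) =
          (1 - p ^ ((n : ℤ) - k)) * invEuler p (n - k) := by
        rw [← invEuler_pred hp]; congr 1; ring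
      have u3 : invEuler p (n - (k - 1)) = invEuler p (((n + 1 : ℕ) : ℤ) - k) := by
        congr 1; push_cast; ring
      have v1 : invEuler p (n + k) =
          (1 - p ^ ((n : ℤ) + 1 + k)) * invEuler p (((n + 1 : ℕ) : ℤ) + k) := by
        rw [show ((n : ℤ) + 1 + k) = ((n + 1 : ℕ) : ℤ) + k by push_cast; ring, ← invEuler_pred hp]
        congr 1; push_cast; ring
      have v2 : invEuler p (n + (k - 1)) =
          (1 - p ^ ((n : ℤ) + k)) * invEuler p (n + k) := by
        rw [← invEuler_pred hp]; congr 1; ring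
      have v3 : invEuler p (n + (k + 1)) = invEuler p (((n + 1 : ℕ) : ℤ) + k) := by
        congr 1; push_cast; ring
      rw [u3, v3, u2, v2, u1, v1]
      generalize invEuler p (((n + 1 : ℕ) : ℤ) - k) = u
      generalize invEuler p (((n + 1 : ℕ) : ℤ) + k) = v
      generalize thetaCoeff z p k = w
      rw [eq_inv_mul_iff_mul_eq₀ (mul_ne_zero n1 n2)]
      simp only [zpow_add₀ hp0, zpow_sub₀ hp0, zpow_natCast, zpow_one, pow_add, pow_mul', pow_one]
      have hk := zpow_ne_zero k hp0
      generalize p ^ k = K at *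
      field_simp
      ring
    · rw [prod_range_succ, e1, eq_inv_mul_iff_mul_eq₀ (mul_ne_zero n1 n2)]
      simp only [pow_add, pow_mul', pow_one]
      field_simp
      ring

/-- `(p;p)_∞`. -/
noncomputable def eulerProd (p : ℂ) : ℂ := ∏' j : ℕ, (1 + -(p ^ (j + 1)))

theorem summable_norm_neg_pow_succ {p : ℂ} (hp : ‖p‖ < 1) :
    Summable fun j : ℕ => ‖-(p ^ (j + 1))‖ := by
  simp only [norm_neg, norm_pow]
  simp only [pow_succ]
  exact (summable_geometric_of_lt_one (norm_nonneg _) hp).mul_right _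

theorem eulerProd_ne_zero {p : ℂ} (hp : ‖p‖ < 1) : eulerProd p ≠ 0 :=
  tprod_one_add_ne_zero_of_summable
    (fun j => by rw [← sub_eq_add_neg]; exact one_sub_pow_ne_zero hp j)
    (summable_norm_neg_pow_succ hp)

theorem tendsto_invEuler {p : ℂ} (hp : ‖p‖ < 1) :
    Tendsto (fun n : ℕ => invEuler p n) atTop (𝓝 (eulerProd p)⁻¹) := by
  have h := ((multipliable_one_add_of_summable
    (summable_norm_neg_pow_succ hp)).tendsto_prod_tprod_nat).inv₀ (eulerProd_ne_zero hp)
  refine h.congr fun n => ?_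
  simp only [← sub_eq_add_neg]
  rfl

theorem tendsto_invEuler_comp {p : ℂ} (hp : ‖p‖ < 1) {f : ℕ → ℤ} (hf : Tendsto f atTop atTop) :
    Tendsto (fun n : ℕ => invEuler p (f n)) atTop (𝓝 (eulerProd p)⁻¹) := by
  have h1 : Tendsto (fun n => (f n).toNat) atTop atTop :=
    tendsto_atTop.2 fun b => by
      filter_upwards [hf.eventually_ge_atTop (b : ℤ)] with n hn; omega
  refine ((tendsto_invEuler hp).comp h1).congr' ?_
  filter_upwards [hf.eventually_ge_atTop 0] with n hn
  simp [Int.toNat_of_nonneg hn]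

/-- Supplies the domination for the passage to the limit in the finite triple product. -/
theorem exists_norm_invEuler_le {p : ℂ} (hp : ‖p‖ < 1) :
    ∃ C : ℝ, 0 ≤ C ∧ ∀ m, ‖invEuler p m‖ ≤ C := by
  obtain ⟨C, hC⟩ := (Metric.isBounded_range_of_tendsto _ (tendsto_invEuler hp)).exists_norm_le
  have h0 : 0 ≤ C := (norm_nonneg _).trans (hC _ ⟨0, rfl⟩)
  refine ⟨C, h0, fun m => ?_⟩
  rcases m with n | n
  · exact hC _ ⟨n, rfl⟩
  · simpa [invEuler] using h0

/-- The Jacobi triple product identity. -/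
theorem eulerProd_mul_ellTheta {z p : ℂ} (hz : z ≠ 0) (hp0 : p ≠ 0) (hp : ‖p‖ < 1) :
    eulerProd p * ellTheta z p = ∑' k : ℤ, thetaCoeff z p k := by
  obtain ⟨C, hC0, hC⟩ := exists_norm_invEuler_le hp
  have hs := (summable_thetaCoeff hz hp0 hp).norm
  -- Let `n → ∞` in the finite identity: both `invEuler` factors in the summand, and the one in
  -- front of the product, tend to `(eulerProd p)⁻¹`.
  have hlim : Tendsto (fun n : ℕ => ∑' k : ℤ,
      thetaCoeff z p k * (invEuler p (n - k) * invEuler p (n + k))) atTop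
      (𝓝 (∑' k : ℤ, thetaCoeff z p k * ((eulerProd p)⁻¹ * (eulerProd p)⁻¹))) := by
    refine tendsto_tsum_of_dominated_convergence (hs.mul_right (C * C)) (fun k => ?_)
      (Eventually.of_forall fun n k => ?_)
    · refine ((tendsto_invEuler_comp hp ?_).mul (tendsto_invEuler_comp hp ?_)).const_mul _
      · exact tendsto_atTop_add_const_right _ (-k) tendsto_natCast_atTop_atTop
      · exact tendsto_atTop_add_const_right _ k tendsto_natCast_atTop_atTop
    · rw [norm_mul, norm_mul]
      gcongr
      · exact hC _
      · exact hC _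
  simp only [(hasSum_finite_triple_product hz hp0 hp _).tsum_eq] at hlim
  have hlim2 := ((tendsto_invEuler_comp hp (f := fun n : ℕ => 2 * (n : ℤ))
    (tendsto_natCast_atTop_atTop.const_mul_atTop' two_pos)).mul (tendsto_prod_ellTheta hp z))
  have := tendsto_nhds_unique hlim hlim2
  rw [tsum_mul_right] at this
  have hP := eulerProd_ne_zero hp
  field_simp at this
  rw [this]

/-! ### The addition formula -/

/-- In the theta series substitute `k ↦ 1 - k`: `triExp` is invariant and the sign flips. The series
needs `p ≠ 0`, hence the separate case. -/
theorem ellTheta_inv {z p : ℂ} (hz : z ≠ 0) (hp : ‖p‖ < 1) :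
    ellTheta z⁻¹ p = -(ellTheta z p / z) := by
  rcases eq_or_ne p 0 with rfl | hp0
  · rw [ellTheta_zero_nome, ellTheta_zero_nome]; field_simp; ring
  have hP := eulerProd_ne_zero hp
  have h1 := eulerProd_mul_ellTheta (inv_ne_zero hz) hp0 hp
  have h2 := eulerProd_mul_ellTheta hz hp0 hp
  have h3 : ∑' k : ℤ, thetaCoeff z⁻¹ p k = ∑' k : ℤ, -(thetaCoeff z p k / z) := by
    rw [← (Equiv.subLeft (1 : ℤ)).tsum_eq (thetaCoeff z⁻¹ p)]
    refine tsum_congr fun k => ?_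
    simp only [Equiv.subLeft_apply, thetaCoeff]
    have e : triExp (1 - k) = triExp k := by
      have h1 := two_mul_triExp (1 - k)
      have h2 := two_mul_triExp k
      nlinarith
    have s : ((-1 : ℂ)) ^ (1 - k) = -(-1) ^ k := by
      rw [zpow_sub₀ (by norm_num), zpow_one]
      rcases Int.even_or_odd k with h | h
      · rw [h.neg_one_zpow]; norm_num
      · rw [h.neg_one_zpow]; norm_num
    rw [e, s, inv_zpow', neg_sub, zpow_sub_one₀ hz]
    ring
  rw [tsum_neg, tsum_div_const] at h3
  rw [h3, ← h2] at h1
  refine mul_left_cancel₀ hP ?_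
  rw [h1]; ring

/-- Splitting of pairs of integers according to the parity of their sum. -/
def parityMap : (ℤ × ℤ) ⊕ (ℤ × ℤ) → ℤ × ℤ
  | Sum.inl x => (x.1 + x.2, x.1 - x.2)
  | Sum.inr x => (x.1 + x.2 + 1, x.1 - x.2)

theorem parityMap_bijective : Function.Bijective parityMap := by
  constructor
  · rintro (⟨a, b⟩ | ⟨a, b⟩) (⟨c, d⟩ | ⟨c, d⟩) h <;>
      simp only [parityMap, Prod.mk.injEq] at h <;>
      first | omega | (congr 2 <;> omega)
  · rintro ⟨m, n⟩
    rcases Int.even_or_odd' (m + n) with ⟨c, h | h⟩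
    · exact ⟨Sum.inl (c, m - c), by simp only [parityMap, Prod.mk.injEq]; omega⟩
    · exact ⟨Sum.inr (c, m - c - 1), by simp only [parityMap, Prod.mk.injEq]; omega⟩

/-- General term of the even part of the theta product expansion. -/
noncomputable def evenCoeff (p x : ℂ) (i : ℤ) : ℂ := p ^ (i * i) * x ^ (2 * i)

/-- General term of the odd part of the theta product expansion. -/
noncomputable def oddCoeff (p x : ℂ) (i : ℤ) : ℂ := p ^ (i * i + i) * x ^ (2 * i + 1)

theorem summable_norm_evenCoeff {p x : ℂ} (hp0 : p ≠ 0) (hp : ‖p‖ < 1) (hx : x ≠ 0) :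
    Summable fun i => ‖evenCoeff p x i‖ := by
  have hb := (summable_thetaCoeff (z := x ^ 2 * p) (p := p ^ 2) (by simp [hx, hp0])
    (by simp [hp0]) (by rw [norm_pow]; exact pow_lt_one₀ (norm_nonneg _) hp two_ne_zero)).norm
  refine hb.congr fun i => ?_
  have e : p ^ (i * i) = (p ^ 2) ^ triExp i * p ^ i := by
    rw [← zpow_natCast, ← zpow_mul, ← zpow_add₀ hp0]
    congr 1
    have := two_mul_triExp i
    push_cast; linarith
  simp only [evenCoeff, thetaCoeff, norm_mul, e, norm_zpow, norm_neg, norm_one, one_zpow, mul_zpow,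
    zpow_mul, zpow_ofNat]
  ring

theorem summable_norm_oddCoeff {p x : ℂ} (hp0 : p ≠ 0) (hp : ‖p‖ < 1) (hx : x ≠ 0) :
    Summable fun i => ‖oddCoeff p x i‖ := by
  have hb := (summable_thetaCoeff (z := x ^ 2 * p ^ 2) (p := p ^ 2) (by simp [hx, hp0])
    (by simp [hp0]) (by rw [norm_pow]; exact pow_lt_one₀ (norm_nonneg _) hp two_ne_zero)).norm
  refine (hb.mul_left ‖x‖).congr fun i => ?_
  have e : p ^ (i * i + i) = (p ^ 2) ^ triExp i * p ^ (2 * i) := by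
    rw [← zpow_natCast, ← zpow_mul, ← zpow_add₀ hp0]
    congr 1
    have := two_mul_triExp i
    push_cast; linarith
  simp only [oddCoeff, thetaCoeff, norm_mul, e, norm_zpow, norm_neg, norm_one, one_zpow, mul_zpow,
    zpow_mul, zpow_ofNat, zpow_add_one₀ hx]
  ring

/-- The cross terms cancel in the exponent, `triExp (i + j) + triExp (i - j) = i * (i - 1) + j * j`,
so the double series separates. The shift to `i - 1` matches the normalisation of `oddCoeff`. -/
theorem thetaCoeff_mul_even {p x y : ℂ} (hp0 : p ≠ 0) (hx : x ≠ 0) (hy : y ≠ 0) (i j : ℤ) :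
    thetaCoeff (x * y) p (i + j) * thetaCoeff (x / y) p (i - j) =
      x * (oddCoeff p x (i - 1) * evenCoeff p y j) := by
  have e : p ^ triExp (i + j) * p ^ triExp (i - j) =
      p ^ ((i - 1) * (i - 1) + (i - 1)) * p ^ (j * j) := by
    rw [← zpow_add₀ hp0, ← zpow_add₀ hp0]
    congr 1
    have h1 := two_mul_triExp (i + j)
    have h2 := two_mul_triExp (i - j)
    nlinarith
  have s : ((-1 : ℂ)) ^ (i + j) * (-1) ^ (i - j) = 1 := by
    rw [← zpow_add₀ (by norm_num)]
    exact Even.neg_one_zpow ⟨i, by ring⟩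
  have X : (x * y) ^ (i + j) * (x / y) ^ (i - j) = x * (x ^ (2 * (i - 1) + 1) * y ^ (2 * j)) := by
    rw [mul_zpow, div_zpow, ← mul_assoc x, ← zpow_one_add₀ hx,
      show 1 + (2 * (i - 1) + 1) = (i + j) + (i - j) by ring, zpow_add₀ hx (i + j),
      show 2 * j = (i + j) - (i - j) by ring, zpow_sub₀ hy (i + j) (i - j)]
    ring
  simp only [thetaCoeff, evenCoeff, oddCoeff]
  linear_combination (p ^ triExp (i + j) * p ^ triExp (i - j) *
    ((x * y) ^ (i + j) * (x / y) ^ (i - j))) * s +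
    ((x * y) ^ (i + j) * (x / y) ^ (i - j)) * e +
    p ^ ((i - 1) * (i - 1) + (i - 1)) * p ^ (j * j) * X

/-- Again the exponent separates: `triExp (i + j + 1) + triExp (i - j) = i * i + (j * j + j)`. -/
theorem thetaCoeff_mul_odd {p x y : ℂ} (hp0 : p ≠ 0) (hx : x ≠ 0) (hy : y ≠ 0) (i j : ℤ) :
    thetaCoeff (x * y) p (i + j + 1) * thetaCoeff (x / y) p (i - j) =
      -(x * (evenCoeff p x i * oddCoeff p y j)) := by
  have e : p ^ triExp (i + j + 1) * p ^ triExp (i - j) = p ^ (i * i) * p ^ (j * j + j) := by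
    rw [← zpow_add₀ hp0, ← zpow_add₀ hp0]
    congr 1
    have h1 := two_mul_triExp (i + j + 1)
    have h2 := two_mul_triExp (i - j)
    nlinarith
  have s : ((-1 : ℂ)) ^ (i + j + 1) * (-1) ^ (i - j) = -1 := by
    rw [← zpow_add₀ (by norm_num)]
    exact Odd.neg_one_zpow ⟨i, by ring⟩
  have X : (x * y) ^ (i + j + 1) * (x / y) ^ (i - j) = x * (x ^ (2 * i) * y ^ (2 * j + 1)) := by
    rw [mul_zpow, div_zpow, ← mul_assoc x, ← zpow_one_add₀ hx,
      show 1 + 2 * i = (i + j + 1) + (i - j) by ring, zpow_add₀ hx (i + j + 1),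
      show 2 * j + 1 = (i + j + 1) - (i - j) by ring, zpow_sub₀ hy (i + j + 1) (i - j)]
    ring
  simp only [thetaCoeff, evenCoeff, oddCoeff]
  linear_combination (p ^ triExp (i + j + 1) * p ^ triExp (i - j) *
    ((x * y) ^ (i + j + 1) * (x / y) ^ (i - j))) * s -
    ((x * y) ^ (i + j + 1) * (x / y) ^ (i - j)) * e -
    p ^ (i * i) * p ^ (j * j + j) * X

theorem tsum_thetaCoeff_mul {p x y : ℂ} (hp0 : p ≠ 0) (hp : ‖p‖ < 1) (hx : x ≠ 0) (hy : y ≠ 0) :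
    (∑' k, thetaCoeff (x * y) p k) * ∑' k, thetaCoeff (x / y) p k =
      x * ((∑' i, oddCoeff p x i) * ∑' i, evenCoeff p y i) -
        x * ((∑' i, evenCoeff p x i) * ∑' i, oddCoeff p y i) := by
  have hsx := summable_thetaCoeff (mul_ne_zero hx hy) hp0 hp
  have hsy := summable_thetaCoeff (div_ne_zero hx hy) hp0 hp
  have hS := summable_mul_of_summable_norm hsx.norm hsy.norm
  have ho : Summable fun i => ‖oddCoeff p x (i - 1)‖ :=
    (Equiv.subRight (1 : ℤ)).summable_iff.2 (summable_norm_oddCoeff hp0 hp hx)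
  have h1 : ∑' i, oddCoeff p x (i - 1) = ∑' i, oddCoeff p x i :=
    (Equiv.subRight (1 : ℤ)).tsum_eq (oddCoeff p x)
  have e1 := (summable_mul_of_summable_norm ho (summable_norm_evenCoeff hp0 hp hy)).hasSum
  have e2 := (summable_mul_of_summable_norm (summable_norm_evenCoeff hp0 hp hx)
    (summable_norm_oddCoeff hp0 hp hy)).hasSum
  rw [← tsum_mul_tsum_of_summable_norm ho (summable_norm_evenCoeff hp0 hp hy), h1] at e1
  rw [← tsum_mul_tsum_of_summable_norm (summable_norm_evenCoeff hp0 hp hx)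
    (summable_norm_oddCoeff hp0 hp hy)] at e2
  -- The pairs of indices are split along `parityMap`; each half is a product of two single series.
  have H : HasSum (fun s => thetaCoeff (x * y) p (parityMap s).1 *
      thetaCoeff (x / y) p (parityMap s).2)
      (x * ((∑' i, oddCoeff p x i) * ∑' i, evenCoeff p y i) +
        -(x * ((∑' i, evenCoeff p x i) * ∑' i, oddCoeff p y i))) := by
    refine HasSum.sum ?_ ?_
    · refine (e1.mul_left x).of_eq (fun s => ?_) rfl
      exact thetaCoeff_mul_even hp0 hx hy s.1 s.2
    · refine (e2.mul_left x).neg.of_eq (fun s => ?_) rfl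
      exact thetaCoeff_mul_odd hp0 hx hy s.1 s.2
  have H' : HasSum (fun s : ℤ × ℤ => thetaCoeff (x * y) p s.1 * thetaCoeff (x / y) p s.2) _ :=
    (Equiv.ofBijective _ parityMap_bijective).hasSum_iff.1 H
  rw [tsum_mul_tsum_of_summable_norm hsx.norm hsy.norm, H'.tsum_eq, sub_eq_add_neg]

/-- A product of two theta functions is a `2 × 2` determinant. -/
theorem exists_ellTheta_mul_ellTheta {p : ℂ} (hp : ‖p‖ < 1) :
    ∃ f g : ℂ → ℂ, ∀ x y : ℂ, x ≠ 0 → y ≠ 0 →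
      ellTheta (x * y) p * ellTheta (x / y) p = x * (f x * g y - g x * f y) := by
  rcases eq_or_ne p 0 with rfl | hp0
  -- For `p = 0`: `(1 - x y)(1 - x / y) = x ((x + 1/x) - (y + 1/y))`.
  · refine ⟨fun x => x + 1 / x, fun _ => 1, fun x y hx hy => ?_⟩
    simp only [ellTheta_zero_nome]; field_simp; ring
  have hP := eulerProd_ne_zero hp
  refine ⟨fun x => (eulerProd p)⁻¹ * ∑' i, oddCoeff p x i,
    fun x => (eulerProd p)⁻¹ * ∑' i, evenCoeff p x i, fun x y hx hy => ?_⟩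
  have h := tsum_thetaCoeff_mul hp0 hp hx hy
  rw [← eulerProd_mul_ellTheta (mul_ne_zero hx hy) hp0 hp,
    ← eulerProd_mul_ellTheta (div_ne_zero hx hy) hp0 hp] at h
  field_simp
  linear_combination h

/-- The Weierstrass–Riemann addition formula. -/
theorem ellTheta_addition {p : ℂ} (hp : ‖p‖ < 1) {l x y u v : ℂ} (hl : l ≠ 0) (hx : x ≠ 0)
    (hy : y ≠ 0) (hu : u ≠ 0) (hv : v ≠ 0) :
    ellTheta (l * x * y) p * ellTheta (x / y) p * (ellTheta (l * u * v) p * ellTheta (u / v) p) -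
      ellTheta (l * x * v) p * ellTheta (x / v) p * (ellTheta (l * u * y) p * ellTheta (u / y) p) =
    u / y * (ellTheta (l * y * v) p * ellTheta (y / v) p *
      (ellTheta (l * x * u) p * ellTheta (x / u) p)) := by
  -- With `l = s ^ 2`, each pair of thetas is `θ(XY) θ(X/Y)` for `X`, `Y` among `s * x`, `s * y`, `s
  -- * u`, `s * v`, hence a 2×2 minor. The claim is then the Plücker relation between the minors of
  -- a 2×4 matrix.
  obtain ⟨s, rfl⟩ := IsAlgClosed.exists_pow_nat_eq l two_pos
  have hs : s ≠ 0 := by rintro rfl; simp at hl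
  obtain ⟨f, g, h⟩ := exists_ellTheta_mul_ellTheta hp
  have key : ∀ a b : ℂ, a ≠ 0 → b ≠ 0 → ellTheta (s ^ 2 * a * b) p * ellTheta (a / b) p =
      s * a * (f (s * a) * g (s * b) - g (s * a) * f (s * b)) := by
    intro a b ha hb
    rw [← h (s * a) (s * b) (mul_ne_zero hs ha) (mul_ne_zero hs hb), mul_div_mul_left _ _ hs]
    congr 2; ring
  rw [key x y hx hy, key u v hu hv, key x v hx hv, key u y hu hy, key y v hy hv, key x u hx hu]
  field_simp
  ring

end

/-! ### Elliptic shifted factorials of natural index -/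

/-- `(x;q,p)_n` for natural `n`. -/
noncomputable def ellPoch (x q p : ℂ) (n : ℕ) : ℂ := ∏ j ∈ range n, ellTheta (x * q ^ j) p

@[simp] theorem ellPoch_zero (x q p : ℂ) : ellPoch x q p 0 = 1 := by simp [ellPoch]

theorem ellPoch_succ (x q p : ℂ) (n : ℕ) :
    ellPoch x q p (n + 1) = ellPoch x q p n * ellTheta (x * q ^ n) p := prod_range_succ _ _

theorem ellPoch_add (x q p : ℂ) (m n : ℕ) :
    ellPoch x q p (m + n) = ellPoch x q p m * ellPoch (x * q ^ m) q p n := by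
  unfold ellPoch
  rw [prod_range_add]
  congr 1
  exact prod_congr rfl fun j _ => by rw [pow_add]; ring_nf

theorem ellPoch_one (x q p : ℂ) : ellPoch x q p 1 = ellTheta x p := by simp [ellPoch]

theorem ellPoch_succ' (x q p : ℂ) (n : ℕ) :
    ellPoch x q p (n + 1) = ellTheta x p * ellPoch (x * q) q p n := by
  rw [add_comm, ellPoch_add, ellPoch_one, pow_one]

theorem ellPoch_ne_zero {x q p : ℂ} {n : ℕ} (h : ∀ j < n, ellTheta (x * q ^ j) p ≠ 0) :
    ellPoch x q p n ≠ 0 :=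
  prod_ne_zero_iff.2 fun j hj => h j (mem_range.1 hj)

theorem ellTheta_of_mul_eq_one {p : ℂ} (hp : ‖p‖ < 1) {x y : ℂ} (hx : x ≠ 0) (h : x * y = 1) :
    ellTheta y p = -(ellTheta x p * y) := by
  obtain rfl : y = x⁻¹ := eq_inv_of_mul_eq_one_right h
  rw [ellTheta_inv hx hp]; ring

/-! ### The Frenkel–Turaev summation -/

/-- The factors of a very-well-poised term which do not involve the terminating parameter. -/
noncomputable def wpPart (Q p a b c d e : ℂ) (k : ℕ) : ℂ :=
  ellTheta (a * Q ^ (2 * k)) p / ellTheta a p * (ellPoch a Q p k / ellPoch Q Q p k) *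
    (ellPoch b Q p k / ellPoch (a * Q / b) Q p k) * (ellPoch c Q p k / ellPoch (a * Q / c) Q p k) *
    (ellPoch d Q p k / ellPoch (a * Q / d) Q p k) * (ellPoch e Q p k / ellPoch (a * Q / e) Q p k)

/-- The general term of the Frenkel–Turaev sum. -/
noncomputable def ftTerm (Q p a b c d e : ℂ) (n k : ℕ) : ℂ :=
  -- The usual terminating factor `(Q^(-n))_k / (a Q^(n+1))_k * Q^k` is expressed through
  -- `(Q)_(n-k)` and `(aQ)_(n+k)`, and the whole sum is divided by `(Q)_n (aQ)_n`. No negative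
  -- powers of `Q` remain inside the factorials.
  wpPart Q p a b c d e k * ((-1) ^ k * Q ^ ((k + 1).choose 2) / Q ^ (n * k)) /
    (ellPoch Q Q p (n - k) * ellPoch (a * Q) Q p (n + k))

/-- The value of the Frenkel–Turaev sum. -/
noncomputable def ftValue (Q p a b c d : ℂ) (n : ℕ) : ℂ :=
  ellPoch (a * Q / (b * c)) Q p n * ellPoch (a * Q / (b * d)) Q p n *
    ellPoch (a * Q / (c * d)) Q p n /
  (ellPoch Q Q p n * ellPoch (a * Q / b) Q p n * ellPoch (a * Q / c) Q p n *
    ellPoch (a * Q / d) Q p n * ellPoch (a * Q / (b * c * d)) Q p n)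

theorem choose_two_succ (k : ℕ) : (k + 1).choose 2 = k.choose 2 + k := by
  rw [Nat.choose_succ_succ' k 1, Nat.choose_one_right, add_comm]

/-- Splitting of the factors depending on `e`. -/
theorem ft_split {p : ℂ} (hp : ‖p‖ < 1) {Q a e : ℂ} (hQ : Q ≠ 0) (ha : a ≠ 0) (he : e ≠ 0)
    (k l : ℕ) :
    ellTheta (a * Q ^ k / e) p * ellTheta (e * Q ^ k) p *
        (ellTheta (a * Q ^ (k + l)) p * ellTheta (Q ^ (k + l)) p) =
      Q ^ k * (ellTheta (a * Q ^ (k + (k + l))) p * ellTheta (Q ^ l) p *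
        (ellTheta (a / e) p * ellTheta e p)) +
      ellTheta (a * Q ^ (k + l) / e) p * ellTheta (e * Q ^ (k + l)) p *
        (ellTheta (a * Q ^ k) p * ellTheta (Q ^ k) p) := by
  have hk := pow_ne_zero k hQ
  have hl := pow_ne_zero l hQ
  have hkl := pow_ne_zero (k + l) hQ
  -- The arguments are `x = Q ^ k`, `y = Q ^ (k + l)`, `u = 1`, `v = 1 / e`.
  have h := ellTheta_addition hp ha hk hkl one_ne_zero (inv_ne_zero he)
  have i1 : ellTheta (Q ^ k / Q ^ (k + l)) p = -(ellTheta (Q ^ l) p * (Q ^ k / Q ^ (k + l))) :=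
    ellTheta_of_mul_eq_one hp hl (by rw [pow_add]; field_simp)
  have i2 : ellTheta (1 / Q ^ (k + l)) p = -(ellTheta (Q ^ (k + l)) p * (1 / Q ^ (k + l))) :=
    ellTheta_of_mul_eq_one hp hkl (by field_simp)
  rw [i1, i2] at h
  rw [show a * Q ^ k * Q ^ (k + l) = a * Q ^ (k + (k + l)) by ring,
    show a * 1 * e⁻¹ = a / e by ring, show 1 / e⁻¹ = e by simp,
    show a * Q ^ k * e⁻¹ = a * Q ^ k / e by ring, show Q ^ k / e⁻¹ = e * Q ^ k by simp [mul_comm],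
    show a * 1 * Q ^ (k + l) = a * Q ^ (k + l) by ring,
    show a * Q ^ (k + l) * e⁻¹ = a * Q ^ (k + l) / e by ring,
    show Q ^ (k + l) / e⁻¹ = e * Q ^ (k + l) by simp [mul_comm],
    show a * Q ^ k * 1 = a * Q ^ k by ring, show Q ^ k / 1 = Q ^ k by simp] at h
  have h' : (Q ^ (k + l))⁻¹ * Q ^ (k + l) = 1 := inv_mul_cancel₀ hkl
  linear_combination Q ^ (k + l) * h + (Q ^ k * (ellTheta (a * Q ^ (k + (k + l))) p *
    ellTheta (Q ^ l) p * (ellTheta (a / e) p * ellTheta e p)) +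
    ellTheta (a * Q ^ (k + l) / e) p * ellTheta (e * Q ^ (k + l)) p *
        (ellTheta (a * Q ^ k) p * ellTheta (Q ^ k) p) - ellTheta (a * Q ^ k / e) p * ellTheta (e * Q ^ k) p *
        (ellTheta (a * Q ^ (k + l)) p * ellTheta (Q ^ (k + l)) p)) * h'

/-- The addition formula with base `1 / (b c)` and points `x`, `b c`, `x / d`, `c`. For `x = a * Q ^
(n + 1)` it is the core of the recurrence satisfied by `ftValue`. -/
theorem ft_value_relation {p : ℂ} (hp : ‖p‖ < 1) {x b c d : ℂ} (hx : x ≠ 0) (hb : b ≠ 0)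
    (hc : c ≠ 0) (hd : d ≠ 0) :
    ellTheta x p * ellTheta (x / (b * c)) p * (ellTheta (x / (b * d)) p * ellTheta (x / (c * d)) p) -
      ellTheta (x / b) p * ellTheta (x / c) p * (ellTheta (x / d) p * ellTheta (x / (b * c * d)) p) =
    x / (b * c * d) * (ellTheta b p * ellTheta c p *
      (ellTheta (x ^ 2 / (b * c * d)) p * ellTheta d p)) := by
  have hbc := mul_ne_zero hb hc
  have h := ellTheta_addition hp (inv_ne_zero hbc) hx hbc (div_ne_zero hx hd) hc
  rw [show (b * c)⁻¹ * x * (b * c) = x by field_simp,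
    show (b * c)⁻¹ * (x / d) * c = x / (b * d) by field_simp,
    show x / d / c = x / (c * d) by field_simp,
    show (b * c)⁻¹ * x * c = x / b by field_simp,
    show (b * c)⁻¹ * (x / d) * (b * c) = x / d by field_simp,
    show x / d / (b * c) = x / (b * c * d) by field_simp,
    show (b * c)⁻¹ * (b * c) * c = c by field_simp,
    show b * c / c = b by field_simp,
    show (b * c)⁻¹ * x * (x / d) = x ^ 2 / (b * c * d) by field_simp,
    show x / (x / d) = d by field_simp] at h
  rw [h]; ring

/-- The common factor of the terms of two neighbouring Frenkel–Turaev sums. -/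
noncomputable def ftCommon (Q p a b c d e : ℂ) (n k : ℕ) : ℂ :=
  wpPart Q p a b c d e k * ((-1) ^ k * Q ^ ((k + 1).choose 2) / Q ^ ((n + 1) * k)) /
    (ellTheta e p * ellTheta (a / e) p * (ellPoch Q Q p (n + 1 - k) *
      ellPoch (a * Q) Q p (n + 1 + k)))

theorem wpPart_mul_right {p Q a b c d e : ℂ} (hQ : Q ≠ 0) {k : ℕ}
    (he : ellTheta e p ≠ 0) (hae : ∀ j : ℕ, ellTheta (a * Q ^ j / e) p ≠ 0) :
    wpPart Q p a b c d (e * Q) k =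
      wpPart Q p a b c d e k / (ellTheta e p * ellTheta (a / e) p) *
        (ellTheta (a * Q ^ k / e) p * ellTheta (e * Q ^ k) p) := by
  unfold wpPart
  have e1 : ellPoch (e * Q) Q p k = ellPoch e Q p k * ellTheta (e * Q ^ k) p / ellTheta e p := by
    rw [eq_div_iff he, mul_comm, ← ellPoch_succ', ← ellPoch_succ]
  have e2 : ellPoch (a * Q / (e * Q)) Q p k =
      ellTheta (a / e) p * ellPoch (a * Q / e) Q p k / ellTheta (a * Q ^ k / e) p := by
    rw [eq_div_iff (hae k), show a * Q / (e * Q) = a / e by field_simp,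
      show a * Q ^ k / e = a / e * Q ^ k by ring, ← ellPoch_succ, ellPoch_succ',
      show a / e * Q = a * Q / e by ring]
  rw [e1, e2]
  simp only [div_eq_mul_inv, mul_inv, inv_inv]
  ring

/-- Dropping the first factor of each product amounts to `a ↦ a Q²` and `x ↦ x Q` for the other
parameters, since `a Q / x` then becomes `(a Q / x) Q`. -/
theorem wpPart_succ {p Q a b c d e : ℂ} (hQ : Q ≠ 0) {i : ℕ}
    (hQj : ∀ j : ℕ, ellTheta (Q ^ (j + 1)) p ≠ 0) (haj : ∀ j : ℕ, ellTheta (a * Q ^ j) p ≠ 0) :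
    wpPart Q p a b c d e (i + 1) *
        (ellTheta (a * Q ^ (i + 1)) p * ellTheta (Q ^ (i + 1)) p) =
      wpPart Q p (a * Q ^ 2) (b * Q) (c * Q) (d * Q) (e * Q) i *
        (ellTheta (a * Q) p * ellTheta (a * Q ^ 2) p *
          (ellTheta b p / ellTheta (a * Q / b) p * (ellTheta c p / ellTheta (a * Q / c) p) *
          (ellTheta d p / ellTheta (a * Q / d) p) * (ellTheta e p / ellTheta (a * Q / e) p))) := by
  have s : ∀ x, ellPoch x Q p (i + 1) / ellPoch (a * Q / x) Q p (i + 1) =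
      ellPoch (x * Q) Q p i / ellPoch (a * Q ^ 2 * Q / (x * Q)) Q p i *
        (ellTheta x p / ellTheta (a * Q / x) p) := by
    intro x
    rw [ellPoch_succ' x, ellPoch_succ' (a * Q / x),
      show a * Q ^ 2 * Q / (x * Q) = a * Q / x * Q by field_simp]
    simp only [div_eq_mul_inv, mul_inv]; ring
  have h1 := hQj i
  have h2 : ellTheta a p ≠ 0 := by simpa using haj 0
  have h3 := haj 2
  have ea : ellPoch a Q p (i + 1) * ellTheta (a * Q ^ (i + 1)) p =
      ellTheta a p * ellTheta (a * Q) p * ellPoch (a * Q ^ 2) Q p i := by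
    rw [← ellPoch_succ, ellPoch_succ', ellPoch_succ', show a * Q * Q = a * Q ^ 2 by ring, mul_assoc]
  have eq : ellPoch Q Q p (i + 1) = ellPoch Q Q p i * ellTheta (Q ^ (i + 1)) p := by
    rw [ellPoch_succ, pow_succ']
  unfold wpPart
  rw [s b, s c, s d, s e, eq, show a * Q ^ (2 * (i + 1)) = a * Q ^ 2 * Q ^ (2 * i) by ring]
  have core : ellTheta (a * Q ^ 2 * Q ^ (2 * i)) p / ellTheta a p *
      (ellPoch a Q p (i + 1) / (ellPoch Q Q p i * ellTheta (Q ^ (i + 1)) p)) *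
      (ellTheta (a * Q ^ (i + 1)) p * ellTheta (Q ^ (i + 1)) p) =
      ellTheta (a * Q ^ 2 * Q ^ (2 * i)) p / ellTheta (a * Q ^ 2) p *
      (ellPoch (a * Q ^ 2) Q p i / ellPoch Q Q p i) *
      (ellTheta (a * Q) p * ellTheta (a * Q ^ 2) p) := by
    have h4 : ellPoch Q Q p i ≠ 0 := ellPoch_ne_zero fun j _ => by
      rw [← pow_succ']; exact hQj j
    field_simp
    linear_combination ellTheta (a * Q ^ 2 * Q ^ (2 * i)) p * ea
  linear_combination (ellPoch (b * Q) Q p i / ellPoch (a * Q ^ 2 * Q / (b * Q)) Q p i *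
        (ellTheta b p / ellTheta (a * Q / b) p)) *
    (ellPoch (c * Q) Q p i / ellPoch (a * Q ^ 2 * Q / (c * Q)) Q p i *
        (ellTheta c p / ellTheta (a * Q / c) p)) *
    (ellPoch (d * Q) Q p i / ellPoch (a * Q ^ 2 * Q / (d * Q)) Q p i *
        (ellTheta d p / ellTheta (a * Q / d) p)) *
    (ellPoch (e * Q) Q p i / ellPoch (a * Q ^ 2 * Q / (e * Q)) Q p i *
        (ellTheta e p / ellTheta (a * Q / e) p)) * core

theorem ftTerm_succ_eq {p Q a b c d e : ℂ} (hQ : Q ≠ 0) {n k : ℕ}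
    (he : ellTheta e p ≠ 0) (hae : ∀ j : ℕ, ellTheta (a * Q ^ j / e) p ≠ 0) :
    ftTerm Q p a b c d (e * Q) (n + 1) k =
      ftCommon Q p a b c d e n k * (ellTheta (a * Q ^ k / e) p * ellTheta (e * Q ^ k) p) := by
  unfold ftTerm ftCommon
  rw [wpPart_mul_right hQ he hae]
  simp only [div_eq_mul_inv, mul_inv]
  ring

/-- First half of `ft_split`: its thetas cancel the last factors of `(Q)_(n+1-k)` and
`(aQ)_(n+1+k)`, which lowers `n` by one. -/
theorem ftCommon_mul_left {p Q a b c d e : ℂ} (hQ : Q ≠ 0) {n k : ℕ} (hk : k ≤ n)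
    (hQj : ∀ j : ℕ, ellTheta (Q ^ (j + 1)) p ≠ 0) (haj : ∀ j : ℕ, ellTheta (a * Q ^ j) p ≠ 0)
    (he : ellTheta e p ≠ 0) (hae : ellTheta (a / e) p ≠ 0) :
    ftCommon Q p a b c d e n k * (Q ^ k * (ellTheta (a * Q ^ (k + (n + 1))) p *
      ellTheta (Q ^ (n + 1 - k)) p * (ellTheta (a / e) p * ellTheta e p))) =
    ftTerm Q p a b c d e n k := by
  obtain ⟨l, rfl⟩ := Nat.exists_eq_add_of_le hk
  unfold ftTerm ftCommon
  rw [show k + l + 1 - k = l + 1 by omega, show k + l - k = l by omega, ellPoch_succ Q Q p l,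
    show k + l + 1 + k = k + l + k + 1 by ring, ellPoch_succ (a * Q),
    show Q * Q ^ l = Q ^ (l + 1) by ring,
    show a * Q * Q ^ (k + l + k) = a * Q ^ (k + (k + l + 1)) by ring,
    show Q ^ ((k + l + 1) * k) = Q ^ ((k + l) * k) * Q ^ k by ring]
  have h3 := hQj l
  have h4 := haj (k + (k + l + 1))
  have h5 := pow_ne_zero k hQ
  have h6 := pow_ne_zero ((k + l) * k) hQ
  have h7 : ellPoch Q Q p l ≠ 0 := ellPoch_ne_zero fun j _ => by
    rw [← pow_succ']; exact hQj j
  have h8 : ellPoch (a * Q) Q p (k + l + k) ≠ 0 := ellPoch_ne_zero fun j _ => by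
    rw [mul_assoc, ← pow_succ']; exact haj _
  field_simp

/-- The coefficient of the shifted sum in the recurrence for the Frenkel–Turaev sum. -/
noncomputable def ftCoeff (Q p a b c d e : ℂ) (n : ℕ) : ℂ :=
  -(ellTheta (a * Q ^ (n + 1) / e) p * ellTheta (e * Q ^ (n + 1)) p *
    (ellTheta b p / ellTheta (a * Q / b) p * (ellTheta c p / ellTheta (a * Q / c) p) *
      (ellTheta d p / ellTheta (a * Q / d) p))) /
  (Q ^ n * (ellTheta (a * Q / e) p * ellTheta (a / e) p))

/-- Second half of `ft_split`: it vanishes at `k = 0`, so `k = i + 1`, and `wpPart_succ` absorbs the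
shift into the parameters. -/
theorem ftCommon_mul_right {p Q a b c d e : ℂ} (hQ : Q ≠ 0) {n i : ℕ} (hi : i ≤ n)
    (hQj : ∀ j : ℕ, ellTheta (Q ^ (j + 1)) p ≠ 0) (haj : ∀ j : ℕ, ellTheta (a * Q ^ j) p ≠ 0)
    (he : ellTheta e p ≠ 0) (hae : ∀ j : ℕ, ellTheta (a * Q ^ j / e) p ≠ 0) :
    ftCommon Q p a b c d e n (i + 1) * (ellTheta (a * Q ^ (n + 1) / e) p *
      ellTheta (e * Q ^ (n + 1)) p *
        (ellTheta (a * Q ^ (i + 1)) p * ellTheta (Q ^ (i + 1)) p)) =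
    ftCoeff Q p a b c d e n * ftTerm Q p (a * Q ^ 2) (b * Q) (c * Q) (d * Q) (e * Q) n i := by
  obtain ⟨l, rfl⟩ := Nat.exists_eq_add_of_le hi
  have h := wpPart_succ (b := b) (c := c) (d := d) (e := e) hQ (i := i) hQj haj
  have h1 : ellTheta (a * Q) p ≠ 0 := by simpa using haj 1
  have h2 := haj 2
  have e1 : ellPoch (a * Q) Q p (i + l + 1 + (i + 1)) =
      ellTheta (a * Q) p * ellTheta (a * Q ^ 2) p * ellPoch (a * Q ^ 2 * Q) Q p (i + l + i) := by
    rw [show i + l + 1 + (i + 1) = i + l + i + 1 + 1 by ring, ellPoch_succ', ellPoch_succ',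
      show a * Q * Q = a * Q ^ 2 by ring]
    ring
  have h3 : ellTheta (a / e) p ≠ 0 := by simpa using hae 0
  have h4 : ellTheta (a * Q / e) p ≠ 0 := by simpa using hae 1
  have h5 := pow_ne_zero (i + l) hQ
  have h7 : ellPoch Q Q p l ≠ 0 := ellPoch_ne_zero fun j _ => by
    rw [← pow_succ']; exact hQj j
  have h8 : ellPoch (a * Q ^ 2 * Q) Q p (i + l + i) ≠ 0 := ellPoch_ne_zero fun j _ => by
    rw [show a * Q ^ 2 * Q * Q ^ j = a * Q ^ (j + 3) by ring]; exact haj _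
  have e2 : (-1 : ℂ) ^ (i + 1) * Q ^ ((i + 1 + 1).choose 2) / Q ^ ((i + l + 1) * (i + 1)) =
      -((-1 : ℂ) ^ i * Q ^ ((i + 1).choose 2) / Q ^ ((i + l) * i)) / Q ^ (i + l) := by
    rw [choose_two_succ (i + 1)]
    have := pow_ne_zero ((i + l + 1) * (i + 1)) hQ
    have := pow_ne_zero ((i + l) * i) hQ
    have := pow_ne_zero (i + l) hQ
    field_simp
    ring
  unfold ftTerm ftCommon ftCoeff
  rw [e1, e2, show i + l + 1 - (i + 1) = l by omega, show i + l - i = l by omega]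
  generalize (-1 : ℂ) ^ i * Q ^ ((i + 1).choose 2) / Q ^ ((i + l) * i) = w
  generalize wpPart Q p a b c d e (i + 1) = W at *
  generalize wpPart Q p (a * Q ^ 2) (b * Q) (c * Q) (d * Q) (e * Q) i = W' at *
  generalize ellTheta b p / ellTheta (a * Q / b) p = tb at *
  generalize ellTheta c p / ellTheta (a * Q / c) p = tc at *
  generalize ellTheta d p / ellTheta (a * Q / d) p = td at *
  generalize ellPoch (a * Q ^ 2 * Q) Q p (i + l + i) = A at *
  field_simp at h ⊢
  linear_combination (-w * ellTheta (a * Q ^ (i + l + 1) / e) p *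
    ellTheta (e * Q ^ (i + l + 1)) p) * h

/-- The recurrence in `n` for the Frenkel–Turaev sum. -/
theorem ft_sum_recurrence {p : ℂ} (hp : ‖p‖ < 1) {Q a b c d e : ℂ} (hQ : Q ≠ 0) (ha : a ≠ 0)
    (he0 : e ≠ 0) (n : ℕ)
    (hQj : ∀ j : ℕ, ellTheta (Q ^ (j + 1)) p ≠ 0) (haj : ∀ j : ℕ, ellTheta (a * Q ^ j) p ≠ 0)
    (he : ellTheta e p ≠ 0) (hae : ∀ j : ℕ, ellTheta (a * Q ^ j / e) p ≠ 0) :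
    (∑ k ∈ range (n + 2), ftTerm Q p a b c d (e * Q) (n + 1) k) *
        (ellTheta (a * Q ^ (n + 1)) p * ellTheta (Q ^ (n + 1)) p) =
      ∑ k ∈ range (n + 1), ftTerm Q p a b c d e n k +
      ftCoeff Q p a b c d e n *
        ∑ k ∈ range (n + 1), ftTerm Q p (a * Q ^ 2) (b * Q) (c * Q) (d * Q) (e * Q) n k := by
  have hae0 : ellTheta (a / e) p ≠ 0 := by simpa using hae 0
  have hsplit : ∀ k ∈ range (n + 2), ftTerm Q p a b c d (e * Q) (n + 1) k *
      (ellTheta (a * Q ^ (n + 1)) p * ellTheta (Q ^ (n + 1)) p) =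
      ftCommon Q p a b c d e n k * (Q ^ k * (ellTheta (a * Q ^ (k + (n + 1))) p *
        ellTheta (Q ^ (n + 1 - k)) p * (ellTheta (a / e) p * ellTheta e p))) +
      ftCommon Q p a b c d e n k * (ellTheta (a * Q ^ (n + 1) / e) p *
        ellTheta (e * Q ^ (n + 1)) p * (ellTheta (a * Q ^ k) p * ellTheta (Q ^ k) p)) := by
    intro k hk
    obtain ⟨l, hl⟩ := Nat.exists_eq_add_of_le (Nat.lt_succ_iff.1 (mem_range.1 hk))
    have h := ft_split hp hQ ha he0 k l
    rw [← hl] at h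
    rw [ftTerm_succ_eq hQ he hae, show n + 1 - k = l by omega]
    linear_combination ftCommon Q p a b c d e n k * h
  rw [sum_mul, sum_congr rfl hsplit, sum_add_distrib, mul_sum]
  congr 1
  -- The term `k = n + 1` drops out because it contains `θ(1)`.
  · rw [sum_range_succ]
    simp only [Nat.sub_self, pow_zero, ellTheta_one, mul_zero, zero_mul, add_zero]
    exact sum_congr rfl fun k hk =>
      ftCommon_mul_left hQ (Nat.lt_succ_iff.1 (mem_range.1 hk)) hQj haj he hae0
  -- Here it is the term `k = 0` that contains `θ(1)`.
  · rw [sum_range_succ']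
    simp only [pow_zero, ellTheta_one, mul_zero, add_zero]
    exact sum_congr rfl fun k hk =>
      ftCommon_mul_right hQ (Nat.lt_succ_iff.1 (mem_range.1 hk)) hQj haj he hae

/-- The recurrence in `n` for the value of the Frenkel–Turaev sum. -/
theorem ftValue_recurrence {p : ℂ} (hp : ‖p‖ < 1) {Q a b c d e : ℂ} (hQ : Q ≠ 0) (ha : a ≠ 0)
    (hb : b ≠ 0) (hc : c ≠ 0) (hd : d ≠ 0) (n : ℕ) (hbal : b * c * d * e = a ^ 2 * Q ^ (n + 1))
    (hQj : ∀ j : ℕ, ellTheta (Q ^ (j + 1)) p ≠ 0)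
    (hbj : ∀ j : ℕ, ellTheta (a * Q ^ (j + 1) / b) p ≠ 0)
    (hcj : ∀ j : ℕ, ellTheta (a * Q ^ (j + 1) / c) p ≠ 0)
    (hdj : ∀ j : ℕ, ellTheta (a * Q ^ (j + 1) / d) p ≠ 0)
    (hbcd : ∀ j : ℕ, ellTheta (a * Q ^ j / (b * c * d)) p ≠ 0) :
    ftValue Q p a b c d (n + 1) * (ellTheta (a * Q ^ (n + 1)) p * ellTheta (Q ^ (n + 1)) p) =
      ftValue Q p a b c d n + ftCoeff Q p a b c d e n *
        ftValue Q p (a * Q ^ 2) (b * Q) (c * Q) (d * Q) n := by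
  have hbcd0 : b * c * d ≠ 0 := mul_ne_zero (mul_ne_zero hb hc) hd
  have hQn := pow_ne_zero n hQ
  -- The balancing condition eliminates `e`; after inverting the thetas containing `a / e`, common
  -- factors cancel and only the relation `R` is left.
  have he : e = a ^ 2 * Q ^ (n + 1) / (b * c * d) := by
    rw [eq_div_iff hbcd0, ← hbal]; ring
  have R := ft_value_relation hp (x := a * Q ^ (n + 1)) (mul_ne_zero ha (pow_ne_zero _ hQ)) hb hc hd
  have i1 : ellTheta (a * Q ^ (n + 1) / e) p =
      -(ellTheta (a / (b * c * d)) p * (b * c * d / a)) := by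
    rw [show a * Q ^ (n + 1) / e = b * c * d / a by rw [he]; field_simp]
    exact ellTheta_of_mul_eq_one hp (div_ne_zero ha hbcd0) (by field_simp)
  have i2 : ellTheta (a * Q / e) p =
      -(ellTheta (a * Q ^ n / (b * c * d)) p * (b * c * d / (a * Q ^ n))) := by
    rw [show a * Q / e = b * c * d / (a * Q ^ n) by rw [he]; field_simp; ring]
    exact ellTheta_of_mul_eq_one hp (div_ne_zero (mul_ne_zero ha hQn) hbcd0) (by field_simp)
  have i3 : ellTheta (a / e) p =
      -(ellTheta (a * Q ^ (n + 1) / (b * c * d)) p * (b * c * d / (a * Q ^ (n + 1)))) := by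
    rw [show a / e = b * c * d / (a * Q ^ (n + 1)) by rw [he]; field_simp]
    exact ellTheta_of_mul_eq_one hp
      (div_ne_zero (mul_ne_zero ha (pow_ne_zero _ hQ)) hbcd0) (by field_simp)
  have i4 : e * Q ^ (n + 1) = (a * Q ^ (n + 1)) ^ 2 / (b * c * d) := by rw [he]; ring
  have P1 : ∀ x, ellPoch (a * Q / x) Q p (n + 1) =
      ellPoch (a * Q / x) Q p n * ellTheta (a * Q ^ (n + 1) / x) p := by
    intro x
    rw [ellPoch_succ, show a * Q / x * Q ^ n = a * Q ^ (n + 1) / x by ring]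
  have PQ : ellPoch Q Q p (n + 1) = ellPoch Q Q p n * ellTheta (Q ^ (n + 1)) p := by
    rw [ellPoch_succ, pow_succ']
  have Ps : ∀ x, (∀ j : ℕ, ellTheta (a * Q ^ (j + 1) / x) p ≠ 0) →
      ellPoch (a * Q ^ 2 * Q / (x * Q)) Q p n =
      ellPoch (a * Q / x) Q p n * ellTheta (a * Q ^ (n + 1) / x) p / ellTheta (a * Q / x) p := by
    intro x hx
    rw [eq_div_iff (by simpa using hx 0), ← P1, ellPoch_succ',
      show a * Q ^ 2 * Q / (x * Q) = a * Q / x * Q by field_simp, mul_comm]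
  have P3 : ellPoch (a * Q ^ 2 * Q / (b * Q * (c * Q) * (d * Q))) Q p n =
      ellTheta (a / (b * c * d)) p * ellPoch (a * Q / (b * c * d)) Q p n /
        ellTheta (a * Q ^ n / (b * c * d)) p := by
    rw [eq_div_iff (hbcd n), show a * Q ^ n / (b * c * d) = a / (b * c * d) * Q ^ n by ring,
      show a * Q ^ 2 * Q / (b * Q * (c * Q) * (d * Q)) = a / (b * c * d) by field_simp,
      ← ellPoch_succ, ellPoch_succ', show a / (b * c * d) * Q = a * Q / (b * c * d) by ring]
  have P4 : ∀ x y, ellPoch (a * Q ^ 2 * Q / (x * Q * (y * Q))) Q p n =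
      ellPoch (a * Q / (x * y)) Q p n := by
    intro x y
    congr 1; field_simp
  have nP : ∀ x, (∀ j : ℕ, ellTheta (a * Q ^ (j + 1) / x) p ≠ 0) →
      ellPoch (a * Q / x) Q p n ≠ 0 := fun x hx => ellPoch_ne_zero fun j _ => by
    rw [show a * Q / x * Q ^ j = a * Q ^ (j + 1) / x by ring]; exact hx j
  have n1 := nP b hbj
  have n2 := nP c hcj
  have n3 := nP d hdj
  have n4 := nP (b * c * d) fun j => hbcd _
  have n5 : ellPoch Q Q p n ≠ 0 := ellPoch_ne_zero fun j _ => by rw [← pow_succ']; exact hQj j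
  have m1 := hbj n
  have m2 := hcj n
  have m3 := hdj n
  have m4 := hbcd (n + 1)
  have m5 := hQj n
  have m6 := hbcd n
  have m7 : ellTheta (a / (b * c * d)) p ≠ 0 := by simpa using hbcd 0
  have k1 : ellTheta (a * Q / b) p ≠ 0 := by simpa using hbj 0
  have k2 : ellTheta (a * Q / c) p ≠ 0 := by simpa using hcj 0
  have k3 : ellTheta (a * Q / d) p ≠ 0 := by simpa using hdj 0
  unfold ftValue ftCoeff
  rw [P1, P1, P1, P1, P1, P1, P1, PQ, P4, P4, P4, P3, Ps b hbj, Ps c hcj, Ps d hdj, i1, i2, i3, i4]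
  generalize ellTheta (a * Q ^ (n + 1) / (b * c)) p = r1 at *
  generalize ellTheta (a * Q ^ (n + 1) / (b * d)) p = r2 at *
  generalize ellTheta (a * Q ^ (n + 1) / (c * d)) p = r3 at *
  generalize ellTheta (a * Q ^ (n + 1) / (b * c * d)) p = r4 at *
  generalize ellTheta (a * Q ^ (n + 1) / b) p = r5 at *
  generalize ellTheta (a * Q ^ (n + 1) / c) p = r6 at *
  generalize ellTheta (a * Q ^ (n + 1) / d) p = r7 at *
  generalize ellTheta (a * Q ^ (n + 1)) p = r8 at *
  generalize ellTheta ((a * Q ^ (n + 1)) ^ 2 / (b * c * d)) p = r9 at *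
  generalize ellTheta (Q ^ (n + 1)) p = r10 at *
  generalize ellTheta (a / (b * c * d)) p = r11 at *
  generalize ellTheta (a * Q ^ n / (b * c * d)) p = r12 at *
  generalize ellTheta b p = r13 at *
  generalize ellTheta c p = r14 at *
  generalize ellTheta d p = r15 at *
  generalize ellTheta (a * Q / b) p = r16 at *
  generalize ellTheta (a * Q / c) p = r17 at *
  generalize ellTheta (a * Q / d) p = r18 at *
  generalize ellPoch (a * Q / (b * c)) Q p n = s1 at *
  generalize ellPoch (a * Q / (b * d)) Q p n = s2 at *
  generalize ellPoch (a * Q / (c * d)) Q p n = s3 at *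
  generalize ellPoch (a * Q / b) Q p n = s4 at *
  generalize ellPoch (a * Q / c) Q p n = s5 at *
  generalize ellPoch (a * Q / d) Q p n = s6 at *
  generalize ellPoch (a * Q / (b * c * d)) Q p n = s7 at *
  generalize ellPoch Q Q p n = s8 at *
  clear i1 i2 i3 i4 P1 PQ Ps P3 P4 nP hbj hcj hdj hbcd hQj
  field_simp at R ⊢
  linear_combination s1 * s2 * s3 * R

/-- The Frenkel–Turaev summation. -/
theorem frenkel_turaev {p : ℂ} (hp : ‖p‖ < 1) {Q : ℂ} (hQ : Q ≠ 0)
    (hQj : ∀ j : ℕ, ellTheta (Q ^ (j + 1)) p ≠ 0) (n : ℕ) :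
    ∀ {a b c d e : ℂ}, a ≠ 0 → b ≠ 0 → c ≠ 0 → d ≠ 0 → e ≠ 0 →
      b * c * d * e = a ^ 2 * Q ^ (n + 1) →
      (∀ j : ℕ, ellTheta (a * Q ^ j) p ≠ 0) →
      (∀ j : ℕ, ellTheta (a * Q ^ (j + 1) / b) p ≠ 0) →
      (∀ j : ℕ, ellTheta (a * Q ^ (j + 1) / c) p ≠ 0) →
      (∀ j : ℕ, ellTheta (a * Q ^ (j + 1) / d) p ≠ 0) →
      (∀ j : ℤ, ellTheta (e * Q ^ j) p ≠ 0) →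
      (∀ j : ℤ, ellTheta (a / e * Q ^ j) p ≠ 0) →
      ∑ k ∈ range (n + 1), ftTerm Q p a b c d e n k = ftValue Q p a b c d n := by
  induction n with
  | zero =>
    intro a b c d e _ _ _ _ _ _ haj _ _ _ _ _
    have : ellTheta a p ≠ 0 := by simpa using haj 0
    simp [ftTerm, ftValue, wpPart, this]
  | succ n ih =>
    intro a b c d e' ha hb hc hd he' hbal haj hbj hcj hdj hej haej
    -- Both sums of level `n` in the recurrence, with last parameter `e` and `e * Q`, are again
    -- balanced. The hypotheses on the last parameter run over integer powers of `Q`, so they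
    -- survive this shift.
    obtain ⟨e, rfl⟩ : ∃ e, e' = e * Q := ⟨e' / Q, by field_simp⟩
    have he : e ≠ 0 := left_ne_zero_of_mul he'
    have hbal' : b * c * d * e = a ^ 2 * Q ^ (n + 1) := by
      refine mul_right_cancel₀ hQ ?_
      rw [mul_assoc, hbal]; ring
    have hej' : ∀ j : ℤ, ellTheta (e * Q ^ j) p ≠ 0 := fun j => by
      have := hej (j - 1)
      rwa [zpow_sub_one₀ hQ, show e * Q * (Q ^ j * Q⁻¹) = e * Q ^ j by field_simp] at this
    have haej' : ∀ j : ℤ, ellTheta (a / e * Q ^ j) p ≠ 0 := fun j => by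
      have := haej (j + 1)
      rwa [zpow_add_one₀ hQ, show a / (e * Q) * (Q ^ j * Q) = a / e * Q ^ j by field_simp] at this
    have he1 : ellTheta e p ≠ 0 := by simpa using hej' 0
    have hae : ∀ j : ℕ, ellTheta (a * Q ^ j / e) p ≠ 0 := fun j => by
      have := haej' j
      rwa [zpow_natCast, div_mul_eq_mul_div] at this
    have hbcd0 : b * c * d ≠ 0 := mul_ne_zero (mul_ne_zero hb hc) hd
    -- By balancing, `a Q^j / (b c d)` is the inverse of `(a / e) Q^(n+1-j)`.
    have hbcd : ∀ j : ℕ, ellTheta (a * Q ^ j / (b * c * d)) p ≠ 0 := fun j h => by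
      have h1 := haej' (n + 1 - j)
      have e1 : a / e * Q ^ ((n : ℤ) + 1 - j) = (b * c * d) / (a * Q ^ j) := by
        rw [zpow_sub₀ hQ, zpow_natCast, show (n : ℤ) + 1 = ((n + 1 : ℕ) : ℤ) by push_cast; ring,
          zpow_natCast]
        have := pow_ne_zero j hQ
        field_simp
        linear_combination -hbal'
      rw [e1, ellTheta_of_mul_eq_one hp (x := a * Q ^ j / (b * c * d)) (by simp [*]), h] at h1
      · simp at h1
      · have := pow_ne_zero j hQ
        field_simp
    have g : ellTheta (a * Q ^ (n + 1)) p * ellTheta (Q ^ (n + 1)) p ≠ 0 :=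
      mul_ne_zero (haj _) (hQj _)
    refine mul_right_cancel₀ g ?_
    have sh : ∀ x, (∀ j : ℕ, ellTheta (a * Q ^ (j + 1) / x) p ≠ 0) →
        ∀ j : ℕ, ellTheta (a * Q ^ 2 * Q ^ (j + 1) / (x * Q)) p ≠ 0 := fun x hx j => by
      rw [show a * Q ^ 2 * Q ^ (j + 1) / (x * Q) = a * Q ^ (j + 1 + 1) / x by field_simp; ring]
      exact hx _
    rw [ft_sum_recurrence hp hQ ha he n hQj haj he1 hae,
      ftValue_recurrence hp hQ ha hb hc hd n hbal' hQj hbj hcj hdj hbcd,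
      ih ha hb hc hd he hbal' haj hbj hcj hdj hej' haej',
      ih (by simp [*]) (by simp [*]) (by simp [*]) (by simp [*]) he' ?_ (fun j => ?_)
        (sh b hbj) (sh c hcj) (sh d hdj) hej (fun j => ?_)]
    · linear_combination Q ^ 4 * hbal'
    · rw [mul_assoc, ← pow_add]; exact haj _
    · have := haej (j + 2)
      rw [zpow_add₀ hQ] at this
      rwa [show a * Q ^ 2 / (e * Q) * Q ^ j = a / (e * Q) * (Q ^ j * Q ^ (2 : ℤ)) by
        rw [zpow_ofNat]; ring]

/-! ### A cubic orthogonality relation -/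

/-- The weight of the cubic orthogonality relation. -/
noncomputable def cubicWeight (q p M g : ℂ) (L i : ℕ) : ℂ :=
  (-1) ^ i * (q ^ 3) ^ (i.choose 2) *
    (ellPoch (g * q / q ^ i) q p (3 * L + 2) / ellPoch (M * q ^ i) q p (3 * L + 4)) *
    (ellPoch (M * g * (q ^ 3) ^ (i + 1)) (q ^ 3) p L /
      (ellPoch (q ^ 3) (q ^ 3) p (L + 1 - i) * ellPoch (q ^ 3) (q ^ 3) p i))

/-- The addition formula with base `M g` and points `q^(3(i+l))`, `q^i / g`, `q^(3i)`, `1`. When `i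
+ l` is fixed the second factor on the left does not depend on `i`, and the right side consists of
two pieces that telescope. -/
theorem cubic_split {p : ℂ} (hp : ‖p‖ < 1) {q M g : ℂ} (hq : q ≠ 0) (hM : M ≠ 0) (hg : g ≠ 0)
    (i l : ℕ) :
    ellTheta (M * q ^ (4 * i)) p * ellTheta (g * q ^ (2 * i)) p *
        (ellTheta (M * g * (q ^ 3) ^ (i + l)) p * ellTheta ((q ^ 3) ^ (i + l)) p) =
      ellTheta (M * q ^ (3 * (i + l) + i)) p * ellTheta (g * q ^ (3 * (i + l)) / q ^ i) p *
        (ellTheta (M * g * (q ^ 3) ^ i) p * ellTheta ((q ^ 3) ^ i) p) +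
      (q ^ 3) ^ i * (ellTheta (M * q ^ i) p * ellTheta (g / q ^ i) p *
        (ellTheta (M * g * (q ^ 3) ^ (i + l + i)) p * ellTheta ((q ^ 3) ^ l) p)) := by
  have hi := pow_ne_zero i hq
  have hQ := pow_ne_zero 3 hq
  have hQi := pow_ne_zero i hQ
  have hQil := pow_ne_zero (i + l) hQ
  have h := ellTheta_addition hp (mul_ne_zero hM hg) hQil (div_ne_zero hi hg) hQi one_ne_zero
  have i1 : ellTheta (q ^ i / g) p = -(ellTheta (g / q ^ i) p * (q ^ i / g)) :=
    ellTheta_of_mul_eq_one hp (div_ne_zero hg hi) (by field_simp)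
  rw [show M * g * (q ^ 3) ^ (i + l) * (q ^ i / g) = M * q ^ (3 * (i + l) + i) by field_simp; ring,
    show (q ^ 3) ^ (i + l) / (q ^ i / g) = g * q ^ (3 * (i + l)) / q ^ i by field_simp; ring,
    show M * g * (q ^ 3) ^ i * (q ^ i / g) = M * q ^ (4 * i) by field_simp; ring,
    show (q ^ 3) ^ i / (q ^ i / g) = g * q ^ (2 * i) by field_simp; ring,
    show M * g * (q ^ i / g) * 1 = M * q ^ i by field_simp,
    show M * g * (q ^ 3) ^ (i + l) * (q ^ 3) ^ i = M * g * (q ^ 3) ^ (i + l + i) by ring,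
    show (q ^ 3) ^ (i + l) / (q ^ 3) ^ i = (q ^ 3) ^ l by rw [pow_add]; field_simp] at h
  simp only [mul_one, div_one] at h
  rw [i1] at h
  have e : g * q ^ (2 * i) * (q ^ i / g) = (q ^ 3) ^ i := by field_simp; ring
  linear_combination (-1) * h + ellTheta (M * q ^ i) p * ellTheta (g / q ^ i) p *
        (ellTheta (M * g * (q ^ 3) ^ (i + l + i)) p * ellTheta ((q ^ 3) ^ l) p) * e

/-- The weight is built so that the second piece of `cubic_split` at `i` cancels the first piece at
`i + 1`. -/
theorem cubicWeight_telescope {p q M g : ℂ} (hq : q ≠ 0) {L i : ℕ} (hi : i ≤ L)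
    (hQj : ∀ j : ℕ, ellTheta ((q ^ 3) ^ (j + 1)) p ≠ 0)
    (hMj : ∀ j : ℕ, ellTheta (M * q ^ j) p ≠ 0) :
    cubicWeight q p M g L i * ((q ^ 3) ^ i * (ellTheta (M * q ^ i) p * ellTheta (g / q ^ i) p *
        (ellTheta (M * g * (q ^ 3) ^ (L + 1 + i)) p * ellTheta ((q ^ 3) ^ (L + 1 - i)) p))) =
      -(cubicWeight q p M g L (i + 1) * (ellTheta (M * q ^ (3 * (L + 1) + (i + 1))) p *
        ellTheta (g * q ^ (3 * (L + 1)) / q ^ (i + 1)) p *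
        (ellTheta (M * g * (q ^ 3) ^ (i + 1)) p * ellTheta ((q ^ 3) ^ (i + 1)) p))) := by
  obtain ⟨l, rfl⟩ := Nat.exists_eq_add_of_le hi
  have hqi := pow_ne_zero i hq
  unfold cubicWeight
  rw [show i + l + 1 - i = l + 1 by omega, show i + l + 1 - (i + 1) = l by omega, choose_two_succ,
    ellPoch_succ _ _ _ l, ellPoch_succ _ _ _ i]
  have e1 : ellPoch (g * q / q ^ (i + 1)) q p (3 * (i + l) + 2) *
      ellTheta (g * q ^ (3 * (i + l + 1)) / q ^ (i + 1)) p =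
      ellTheta (g / q ^ i) p * ellPoch (g * q / q ^ i) q p (3 * (i + l) + 2) := by
    rw [show g * q ^ (3 * (i + l + 1)) / q ^ (i + 1) =
        g * q / q ^ (i + 1) * q ^ (3 * (i + l) + 2) by field_simp; ring, ← ellPoch_succ,
      ellPoch_succ', show g * q / q ^ (i + 1) = g / q ^ i by field_simp; ring,
      show g / q ^ i * q = g * q / q ^ i by ring]
  have e2 : ellTheta (M * q ^ i) p * ellPoch (M * q ^ (i + 1)) q p (3 * (i + l) + 4) =
      ellPoch (M * q ^ i) q p (3 * (i + l) + 4) *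
        ellTheta (M * q ^ (3 * (i + l + 1) + (i + 1))) p := by
    rw [show M * q ^ (i + 1) = M * q ^ i * q by ring, ← ellPoch_succ', ellPoch_succ]
    congr 2; ring
  have e3 : ellTheta (M * g * (q ^ 3) ^ (i + 1)) p *
        ellPoch (M * g * (q ^ 3) ^ (i + 1 + 1)) (q ^ 3) p (i + l) =
      ellPoch (M * g * (q ^ 3) ^ (i + 1)) (q ^ 3) p (i + l) *
        ellTheta (M * g * (q ^ 3) ^ (i + l + 1 + i)) p := by
    rw [show M * g * (q ^ 3) ^ (i + 1 + 1) = M * g * (q ^ 3) ^ (i + 1) * q ^ 3 by ring,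
      ← ellPoch_succ', ellPoch_succ]
    congr 2; ring
  rw [← pow_succ', ← pow_succ']
  have n1 : ellPoch (M * q ^ i) q p (3 * (i + l) + 4) ≠ 0 := ellPoch_ne_zero fun j _ => by
    rw [mul_assoc, ← pow_add]; exact hMj _
  have n2 : ellPoch (M * q ^ (i + 1)) q p (3 * (i + l) + 4) ≠ 0 := ellPoch_ne_zero fun j _ => by
    rw [mul_assoc, ← pow_add]; exact hMj _
  have n3 : ∀ l, ellPoch (q ^ 3) (q ^ 3) p l ≠ 0 := fun l => ellPoch_ne_zero fun j _ => by
    rw [← pow_succ']; exact hQj _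
  have n4 := n3 l
  have n5 := n3 i
  have n6 := hQj l
  have n7 := hQj i
  rw [pow_succ (-1 : ℂ), pow_add (q ^ 3) (i.choose 2) i]
  generalize ellPoch (g * q / q ^ (i + 1)) q p (3 * (i + l) + 2) = a1 at *
  generalize ellTheta (g * q ^ (3 * (i + l + 1)) / q ^ (i + 1)) p = a2 at *
  generalize ellTheta (g / q ^ i) p = a3 at *
  generalize ellPoch (g * q / q ^ i) q p (3 * (i + l) + 2) = a4 at *
  generalize ellTheta (M * q ^ i) p = a5 at *
  generalize ellPoch (M * q ^ (i + 1)) q p (3 * (i + l) + 4) = a6 at *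
  generalize ellPoch (M * q ^ i) q p (3 * (i + l) + 4) = a7 at *
  generalize ellTheta (M * q ^ (3 * (i + l + 1) + (i + 1))) p = a8 at *
  generalize ellTheta (M * g * (q ^ 3) ^ (i + 1)) p = a9 at *
  generalize ellPoch (M * g * (q ^ 3) ^ (i + 1 + 1)) (q ^ 3) p (i + l) = b1 at *
  generalize ellPoch (M * g * (q ^ 3) ^ (i + 1)) (q ^ 3) p (i + l) = b2 at *
  generalize ellTheta (M * g * (q ^ 3) ^ (i + l + 1 + i)) p = b3 at *
  generalize ellTheta ((q ^ 3) ^ (i + 1)) p = b4 at *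
  generalize ellTheta ((q ^ 3) ^ (l + 1)) p = b5 at *
  generalize ellPoch (q ^ 3) (q ^ 3) p l = b6 at *
  generalize ellPoch (q ^ 3) (q ^ 3) p i = b7 at *
  generalize (q ^ 3) ^ i = b8 at *
  generalize (q ^ 3) ^ i.choose 2 = b9 at *
  generalize (-1 : ℂ) ^ i = c1 at *
  have E : a4 * a3 * a6 * a5 * (b2 * b3) = a7 * a8 * (a1 * a2) * (a9 * b1) := by
    rw [e3, e1]; linear_combination a4 * a3 * b2 * b3 * e2
  field_simp
  linear_combination c1 * b9 * b8 * E

/-- The cubic orthogonality relation. -/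
theorem cubic_orthogonality {p : ℂ} (hp : ‖p‖ < 1) {q M g : ℂ} (hq : q ≠ 0) (hM : M ≠ 0)
    (hg : g ≠ 0) (L : ℕ) (hQj : ∀ j : ℕ, ellTheta ((q ^ 3) ^ (j + 1)) p ≠ 0)
    (hMj : ∀ j : ℕ, ellTheta (M * q ^ j) p ≠ 0)
    (hMg : ellTheta (M * g * (q ^ 3) ^ (L + 1)) p ≠ 0) :
    ∑ i ∈ range (L + 2), cubicWeight q p M g L i *
      (ellTheta (M * q ^ (4 * i)) p * ellTheta (g * q ^ (2 * i)) p) = 0 := by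
  -- Multiply by the nonzero factor independent of `i` that `cubic_split` requires.
  refine (mul_eq_zero_iff_right (mul_ne_zero hMg (hQj L))).1 ?_
  have hs : ∀ i ∈ range (L + 2), cubicWeight q p M g L i *
      (ellTheta (M * q ^ (4 * i)) p * ellTheta (g * q ^ (2 * i)) p) *
      (ellTheta (M * g * (q ^ 3) ^ (L + 1)) p * ellTheta ((q ^ 3) ^ (L + 1)) p) =
      cubicWeight q p M g L i * (ellTheta (M * q ^ (3 * (L + 1) + i)) p *
        ellTheta (g * q ^ (3 * (L + 1)) / q ^ i) p *
        (ellTheta (M * g * (q ^ 3) ^ i) p * ellTheta ((q ^ 3) ^ i) p)) +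
      cubicWeight q p M g L i * ((q ^ 3) ^ i * (ellTheta (M * q ^ i) p * ellTheta (g / q ^ i) p *
        (ellTheta (M * g * (q ^ 3) ^ (L + 1 + i)) p * ellTheta ((q ^ 3) ^ (L + 1 - i)) p))) := by
    intro i hi
    obtain ⟨l, hl⟩ := Nat.exists_eq_add_of_le (Nat.lt_succ_iff.1 (mem_range.1 hi))
    have h := cubic_split hp hq hM hg i l
    rw [← hl] at h
    rw [show L + 1 - i = l by omega]
    linear_combination cubicWeight q p M g L i * h
  -- The first piece vanishes at `i = 0` and the second at `i = L + 1`, both through `θ(1) = 0`; the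
  -- rest cancels in pairs.
  rw [sum_mul, sum_congr rfl hs, sum_add_distrib, sum_range_succ', sum_range_succ _ (L + 1)]
  simp only [pow_zero, ellTheta_one, mul_zero, add_zero, Nat.sub_self]
  rw [← sum_add_distrib]
  refine sum_eq_zero fun i hi => ?_
  rw [cubicWeight_telescope hq (Nat.lt_succ_iff.1 (mem_range.1 hi)) hQj hMj]
  ring

/-! ### The cubic summation, generic parameters -/

/-- Sort the factors by the residue of the exponent modulo 3. This is how base `q` and base `q ^ 3`
interact. -/
theorem ellPoch_cubic (x q p : ℂ) (n : ℕ) :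
    ellPoch x q p (3 * n) =
      ellPoch x (q ^ 3) p n * ellPoch (x * q) (q ^ 3) p n * ellPoch (x * q ^ 2) (q ^ 3) p n := by
  induction n with
  | zero => simp
  | succ n ih =>
    rw [show 3 * (n + 1) = 3 * n + 1 + 1 + 1 by ring]
    simp only [ellPoch_succ, ih]
    rw [show x * q * (q ^ 3) ^ n = x * q ^ (3 * n + 1) by ring,
      show x * q ^ 2 * (q ^ 3) ^ n = x * q ^ (3 * n + 1 + 1) by ring,
      show (q ^ 3) ^ n = q ^ (3 * n) by ring]
    ring

theorem ellPoch_reverse {p : ℂ} (hp : ‖p‖ < 1) {x q : ℂ} (hx : x ≠ 0) (hq : q ≠ 0) (n : ℕ) :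
    ellPoch (x / q ^ n) q p n =
      ellPoch (q / x) q p n * ((-x) ^ n / q ^ ((n + 1).choose 2)) := by
  induction n with
  | zero => simp
  | succ n ih =>
    have h := ellTheta_of_mul_eq_one hp (x := q ^ (n + 1) / x) (y := x / q ^ (n + 1))
      (by simp [*]) (by field_simp)
    rw [ellPoch_succ', show x / q ^ (n + 1) * q = x / q ^ n by field_simp; ring, ih, h,
      ellPoch_succ, show q / x * q ^ n = q ^ (n + 1) / x by ring, choose_two_succ (n + 1)]
    field_simp
    ring

/-- The general term of the cubic sum. -/
noncomputable def cubicTerm (q p m b : ℂ) (n r : ℕ) : ℂ :=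
  ellTheta (m * q ^ (4 * r)) p / ellTheta m p *
    (ellPoch (q / b) q p (2 * r) / ellPoch (m * b) q p (2 * r)) *
    (ellPoch (m * b) q p (3 * n - r) / ellPoch (q ^ 3) (q ^ 3) p (n - r)) *
    (ellPoch (m ^ 2 * b) (q ^ 3) p (n + r) / ellPoch (m * q) q p (3 * n + r)) *
    (q ^ (2 * r.choose 2) * (m * b) ^ r) *
    -- This last factor is the cubic Bailey kernel at index `0` with `a = m / b`.
    (ellPoch b q p r / ellPoch (q ^ 3) (q ^ 3) p r *
      (ellPoch m q p r / ellPoch (m / b * q ^ 3) (q ^ 3) p r))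

/-- The factor in the cubic term complementary to the Frenkel–Turaev value. -/
noncomputable def cubicFront (q p m b : ℂ) (n r : ℕ) : ℂ :=
  (-1) ^ r * (q ^ 3) ^ (r.choose 2) * (ellTheta (m * q ^ (4 * r)) p / ellTheta m p) *
    (ellPoch (m * b) q p (3 * n - r) / ellPoch (m * b) q p (2 * r)) *
    (ellPoch (m ^ 2 * b) (q ^ 3) p (n + r) / ellPoch (q ^ 3) (q ^ 3) p (n - r)) *
    (ellPoch m q p r / ellPoch (m * q) q p (3 * n + r)) *
    ellPoch (m * b * q / q ^ r) q p (3 * r)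

/-- Compares the monomials created by reversing `(b / q^(2r); q)_(2r)` and `(b / m / q^(3r); q^3)_r`
in `ftValue_cubic`. -/
theorem cubic_power_aux {q m b : ℂ} (hq : q ≠ 0) (hm : m ≠ 0) (hb : b ≠ 0) (r : ℕ) :
    q ^ (2 * r.choose 2) * (m * b) ^ r * ((-(b / m)) ^ r / (q ^ 3) ^ ((r + 1).choose 2)) =
      (-1) ^ r * (q ^ 3) ^ (r.choose 2) * ((-b) ^ (2 * r) / q ^ ((2 * r + 1).choose 2)) := by
  have h1 : (2 * r + 1).choose 2 = 2 * r ^ 2 + r := by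
    rw [Nat.choose_two_right, Nat.add_sub_cancel]
    exact Nat.div_eq_of_eq_mul_left two_pos (by ring)
  have h2 : 2 * r.choose 2 + r = r ^ 2 := by
    induction r with
    | zero => simp
    | succ r ih => rw [choose_two_succ]; nlinarith [ih (by
        rw [Nat.choose_two_right, Nat.add_sub_cancel]
        exact Nat.div_eq_of_eq_mul_left two_pos (by ring))]
  rw [choose_two_succ, h1]
  have h3 : q ^ (2 * r.choose 2) * q ^ (2 * r ^ 2 + r) =
      (q ^ 3) ^ (r.choose 2) * (q ^ 3) ^ (r.choose 2 + r) := by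
    rw [← h2]; ring
  have n1 := pow_ne_zero (2 * r ^ 2 + r) hq
  have n2 := pow_ne_zero (r.choose 2 + r) (pow_ne_zero 3 hq)
  have h4 : (m * b) ^ r * (-(b / m)) ^ r = (-1) ^ r * (-b) ^ (2 * r) := by
    rw [pow_mul, ← mul_pow, ← mul_pow]; congr 1; field_simp
  rw [mul_div_assoc', mul_div_assoc', div_eq_div_iff n2 n1]
  linear_combination ((m * b) ^ r * (-(b / m)) ^ r) * h3 +
    (q ^ 3) ^ (r.choose 2) * (q ^ 3) ^ (r.choose 2 + r) * h4

/-- The three numerator products combine into `(b / q^(2r); q)_(3r)`, which splits as `(b / q^(2r);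
q)_(2r) * (b; q)_r`. Three of the denominator products combine into `(m b q / q^r; q)_(3r)`. -/
theorem ftValue_cubic {p : ℂ} (hp : ‖p‖ < 1) {q m b : ℂ} (hq : q ≠ 0) (hm : m ≠ 0) (hb : b ≠ 0)
    (r : ℕ) :
    ftValue (q ^ 3) p (m ^ 2 * b) (m * q ^ r) (m * q ^ (r + 1)) (m * q ^ (r + 2)) r =
      ellPoch (q / b) q p (2 * r) * ((-b) ^ (2 * r) / q ^ ((2 * r + 1).choose 2)) *
        ellPoch b q p r /
      (ellPoch (q ^ 3) (q ^ 3) p r * ellPoch (m * b * q / q ^ r) q p (3 * r) *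
        (ellPoch (m / b * q ^ 3) (q ^ 3) p r *
          ((-(b / m)) ^ r / (q ^ 3) ^ ((r + 1).choose 2)))) := by
  have e1 : ellPoch (m ^ 2 * b * q ^ 3 / (m * q ^ r * (m * q ^ (r + 1)))) (q ^ 3) p r *
      ellPoch (m ^ 2 * b * q ^ 3 / (m * q ^ r * (m * q ^ (r + 2)))) (q ^ 3) p r *
      ellPoch (m ^ 2 * b * q ^ 3 / (m * q ^ (r + 1) * (m * q ^ (r + 2)))) (q ^ 3) p r =
      ellPoch (q / b) q p (2 * r) * ((-b) ^ (2 * r) / q ^ ((2 * r + 1).choose 2)) *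
        ellPoch b q p r := by
    rw [← ellPoch_reverse hp hb hq, show ellPoch b q p r =
      ellPoch (b / q ^ (2 * r) * q ^ (2 * r)) q p r by congr 1; field_simp, ← ellPoch_add,
      show 2 * r + r = 3 * r by ring, ellPoch_cubic,
      show m ^ 2 * b * q ^ 3 / (m * q ^ r * (m * q ^ (r + 1))) = b / q ^ (2 * r) * q ^ 2 by
        field_simp; ring,
      show m ^ 2 * b * q ^ 3 / (m * q ^ r * (m * q ^ (r + 2))) = b / q ^ (2 * r) * q by
        field_simp; ring,
      show m ^ 2 * b * q ^ 3 / (m * q ^ (r + 1) * (m * q ^ (r + 2))) = b / q ^ (2 * r) by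
        field_simp; ring]
    ring
  have e2 : ellPoch (m * b * q / q ^ r) q p (3 * r) =
      ellPoch (m ^ 2 * b * q ^ 3 / (m * q ^ r)) (q ^ 3) p r *
      ellPoch (m ^ 2 * b * q ^ 3 / (m * q ^ (r + 1))) (q ^ 3) p r *
      ellPoch (m ^ 2 * b * q ^ 3 / (m * q ^ (r + 2))) (q ^ 3) p r := by
    rw [ellPoch_cubic,
      show m ^ 2 * b * q ^ 3 / (m * q ^ r) = m * b * q / q ^ r * q ^ 2 by field_simp,
      show m ^ 2 * b * q ^ 3 / (m * q ^ (r + 1)) = m * b * q / q ^ r * q by field_simp; ring,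
      show m ^ 2 * b * q ^ 3 / (m * q ^ (r + 2)) = m * b * q / q ^ r by field_simp; ring]
    ring
  have e3 : ellPoch (m ^ 2 * b * q ^ 3 / (m * q ^ r * (m * q ^ (r + 1)) * (m * q ^ (r + 2))))
      (q ^ 3) p r = ellPoch (m / b * q ^ 3) (q ^ 3) p r *
          ((-(b / m)) ^ r / (q ^ 3) ^ ((r + 1).choose 2)) := by
    rw [show m ^ 2 * b * q ^ 3 / (m * q ^ r * (m * q ^ (r + 1)) * (m * q ^ (r + 2))) =
      b / m / (q ^ 3) ^ r by field_simp; ring, ellPoch_reverse hp (div_ne_zero hb hm)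
        (pow_ne_zero 3 hq), show q ^ 3 / (b / m) = m / b * q ^ 3 by field_simp]
  unfold ftValue
  rw [e1, e3, e2]
  congr 1
  ring

theorem cubicTerm_eq {p : ℂ} (hp : ‖p‖ < 1) {q m b : ℂ} (hq : q ≠ 0) (hm : m ≠ 0) (hb : b ≠ 0)
    {n r : ℕ} (h : ellPoch (m * b * q / q ^ r) q p (3 * r) ≠ 0) :
    cubicTerm q p m b n r = cubicFront q p m b n r *
      ftValue (q ^ 3) p (m ^ 2 * b) (m * q ^ r) (m * q ^ (r + 1)) (m * q ^ (r + 2)) r := by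
  have E := cubic_power_aux hq hm hb r
  rw [ftValue_cubic hp hq hm hb]
  unfold cubicTerm cubicFront
  have n1 : (-(b / m)) ^ r / (q ^ 3) ^ ((r + 1).choose 2) ≠ 0 := by
    have : -(b / m) ≠ 0 := neg_ne_zero.2 (div_ne_zero hb hm)
    simp [hq, hm, hb]
  rw [← eq_div_iff n1] at E
  rw [E]
  generalize ellPoch (m * b * q / q ^ r) q p (3 * r) = A at *
  generalize (-(b / m)) ^ r / (q ^ 3) ^ ((r + 1).choose 2) = B at *
  -- Only the auxiliary factor `A` is cancelled, so no other denominator has to be nonzero.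
  have key : ∀ F N C D : ℂ, F * A * (N / (C * A * D)) = F * (N / (C * D)) := by
    intro F N C D
    rw [mul_assoc, mul_div_assoc', show C * A * D = A * (C * D) by ring, mul_div_mul_left _ _ h]
  rw [key]
  simp only [div_eq_mul_inv, mul_inv]
  ring

/-- The Frenkel–Turaev term for the parameters occurring in the cubic sum. -/
theorem ftTerm_cubic {p q m b : ℂ} (hq : q ≠ 0) (hm : m ≠ 0) (hb : b ≠ 0) (r l : ℕ) :
    ftTerm (q ^ 3) p (m ^ 2 * b) (m * q ^ r) (m * q ^ (r + 1)) (m * q ^ (r + 2)) (m * b ^ 2) r l =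
      ellTheta (m ^ 2 * b * (q ^ 3) ^ (2 * l)) p / ellTheta (m ^ 2 * b) p *
      (ellPoch (m ^ 2 * b) (q ^ 3) p l / ellPoch (q ^ 3) (q ^ 3) p l *
        (ellPoch (m * b ^ 2) (q ^ 3) p l / ellPoch (m / b * q ^ 3) (q ^ 3) p l)) *
      (ellPoch (m * q ^ r) q p (3 * l) / ellPoch (m * b * q / q ^ r) q p (3 * l)) *
      ((-1) ^ l * (q ^ 3) ^ ((l + 1).choose 2) / (q ^ 3) ^ (r * l)) /
      (ellPoch (q ^ 3) (q ^ 3) p (r - l) * ellPoch (m ^ 2 * b * q ^ 3) (q ^ 3) p (r + l)) := by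
  unfold ftTerm wpPart
  rw [ellPoch_cubic (m * q ^ r), ellPoch_cubic (m * b * q / q ^ r),
      show m ^ 2 * b * q ^ 3 / (m * q ^ r) = m * b * q / q ^ r * q ^ 2 by field_simp,
      show m ^ 2 * b * q ^ 3 / (m * q ^ (r + 1)) = m * b * q / q ^ r * q by field_simp; ring,
      show m ^ 2 * b * q ^ 3 / (m * q ^ (r + 2)) = m * b * q / q ^ r by field_simp; ring,
      show m ^ 2 * b * q ^ 3 / (m * b ^ 2) = m / b * q ^ 3 by field_simp,
      show m * q ^ r * q = m * q ^ (r + 1) by ring,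
      show m * q ^ r * q ^ 2 = m * q ^ (r + 2) by ring]
  simp only [div_eq_mul_inv, mul_inv]
  ring

theorem choose_two_add (l i : ℕ) : (l + i).choose 2 = l.choose 2 + i.choose 2 + l * i := by
  induction i with
  | zero => simp
  | succ i ih => rw [← add_assoc, choose_two_succ, choose_two_succ, ih]; ring

theorem two_mul_choose_two (l : ℕ) : 2 * l.choose 2 + l = l * l := by
  induction l with
  | zero => simp
  | succ l ih => rw [choose_two_succ]; nlinarith

/-- The two ranges of exponents share exactly `2 * i`. The doubled factor becomes the second theta
in the orthogonality summand. -/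
theorem ellPoch_overlap {p q g : ℂ} (hq : q ≠ 0) {L i : ℕ} (hi : i ≤ L + 1) :
    ellPoch (g * q / q ^ i) q p (3 * i) * ellPoch (g * q ^ (2 * i)) q p (3 * (L + 1 - i)) =
      ellPoch (g * q / q ^ i) q p (3 * L + 2) * ellTheta (g * q ^ (2 * i)) p := by
  rcases Nat.lt_or_ge i (L + 1) with h | h
  · obtain ⟨s, rfl⟩ := Nat.exists_eq_add_of_le (Nat.lt_succ_iff.1 h)
    rw [show 3 * (i + s + 1 - i) = 3 * s + 2 + 1 by omega, ellPoch_succ',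
      show 3 * (i + s) + 2 = 3 * i + (3 * s + 2) by ring, ellPoch_add _ _ _ (3 * i),
      show g * q / q ^ i * q ^ (3 * i) = g * q ^ (2 * i) * q by field_simp; ring]
    ring
  -- The second product is empty here, and the extra theta is the last factor of the first.
  · obtain rfl : i = L + 1 := le_antisymm hi h
    rw [Nat.sub_self, mul_zero, ellPoch_zero, mul_one, show 3 * (L + 1) = 3 * L + 2 + 1 by ring,
      ellPoch_succ, show g * q / q ^ (L + 1) * q ^ (3 * L + 2) = g * q ^ (2 * (L + 1)) by
        field_simp; ring]

/-- The value of the cubic sum. -/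
noncomputable def cubicValue (q p m b : ℂ) (n : ℕ) : ℂ :=
  ellPoch (m * b ^ 2) (q ^ 3) p n / ellPoch (q ^ 3) (q ^ 3) p n *
    (ellPoch (m ^ 2 * b) (q ^ 3) p n / ellPoch (m / b * q ^ 3) (q ^ 3) p n)

/-- With `r = l + i` and `n = l + L + 1`, everything depending on `i` is the summand of
`cubic_orthogonality` at `M = m q^(4l)`, `g = m b q^(2l)`. -/
theorem cubicFront_mul_ftTerm {p q m b : ℂ} (hq : q ≠ 0) (hm : m ≠ 0) (hb : b ≠ 0)
    {l i L : ℕ} (hi : i ≤ L + 1)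
    (hQj : ∀ j : ℕ, ellTheta ((q ^ 3) ^ (j + 1)) p ≠ 0)
    (hmj : ∀ j : ℕ, ellTheta (m * q ^ j) p ≠ 0)
    (hmb : ∀ j : ℤ, ellTheta (m * b * q ^ j) p ≠ 0)
    (hkj : ∀ j : ℤ, ellTheta (m ^ 2 * b * q ^ j) p ≠ 0) :
    cubicFront q p m b (l + (L + 1)) (l + i) *
      ftTerm (q ^ 3) p (m ^ 2 * b) (m * q ^ (l + i)) (m * q ^ (l + i + 1)) (m * q ^ (l + i + 2))
        (m * b ^ 2) (l + i) l =
      cubicValue q p m b l * ellTheta (m ^ 2 * b * (q ^ 3) ^ (2 * l)) p *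
      (cubicWeight q p (m * q ^ (4 * l)) (m * b * q ^ (2 * l)) L i *
        (ellTheta (m * q ^ (4 * l) * q ^ (4 * i)) p *
          ellTheta (m * b * q ^ (2 * l) * q ^ (2 * i)) p)) := by
  have hk0 : ellTheta (m ^ 2 * b) p ≠ 0 := by simpa using hkj 0
  have hm0 : ellTheta m p ≠ 0 := by simpa using hmj 0
  have hO := ellPoch_overlap (p := p) (g := m * b * q ^ (2 * l)) hq hi
  have A1 : ellPoch (m * b * q / q ^ (l + i)) q p (3 * (l + i)) =
      ellPoch (m * b * q / q ^ (l + i)) q p (3 * l) *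
        ellPoch (m * b * q ^ (2 * l) * q / q ^ i) q p (3 * i) := by
    rw [mul_add, ellPoch_add,
      show m * b * q / q ^ (l + i) * q ^ (3 * l) = m * b * q ^ (2 * l) * q / q ^ i by
        field_simp; ring]
  have A2 : ellPoch (m * b) q p (3 * (l + (L + 1)) - (l + i)) =
      ellPoch (m * b) q p (2 * (l + i)) *
        ellPoch (m * b * q ^ (2 * l) * q ^ (2 * i)) q p (3 * (L + 1 - i)) := by
    rw [show 3 * (l + (L + 1)) - (l + i) = 2 * (l + i) + 3 * (L + 1 - i) by omega, ellPoch_add,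
      show m * b * q ^ (2 * (l + i)) = m * b * q ^ (2 * l) * q ^ (2 * i) by ring]
  have A3 : ellPoch m q p (l + i) * ellPoch (m * q ^ (l + i)) q p (3 * l) *
      ellPoch (m * q ^ (4 * l) * q ^ i) q p (3 * L + 4) =
      ellTheta m p * ellPoch (m * q) q p (3 * (l + (L + 1)) + (l + i)) := by
    rw [← ellPoch_add, show m * q ^ (4 * l) * q ^ i = m * q ^ (l + i + 3 * l) by ring,
      ← ellPoch_add, ← ellPoch_succ']
    congr 1; ring
  have A4 : ellTheta (m ^ 2 * b) p * ellPoch (m ^ 2 * b * q ^ 3) (q ^ 3) p (l + i + l) *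
      ellPoch (m * q ^ (4 * l) * (m * b * q ^ (2 * l)) * (q ^ 3) ^ (i + 1)) (q ^ 3) p L =
      ellPoch (m ^ 2 * b) (q ^ 3) p (l + (L + 1) + (l + i)) := by
    rw [← ellPoch_succ', show m * q ^ (4 * l) * (m * b * q ^ (2 * l)) * (q ^ 3) ^ (i + 1) =
      m ^ 2 * b * (q ^ 3) ^ (l + i + l + 1) by ring, ← ellPoch_add]
    congr 1; ring
  have A5 : (-1 : ℂ) ^ (l + i) * (q ^ 3) ^ ((l + i).choose 2) *
      ((-1) ^ l * (q ^ 3) ^ ((l + 1).choose 2) / (q ^ 3) ^ ((l + i) * l)) =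
      (-1) ^ i * (q ^ 3) ^ (i.choose 2) := by
    have e : (-1 : ℂ) ^ l * (-1) ^ l = 1 := by rw [← mul_pow]; simp
    have f : (q ^ 3) ^ ((l + i).choose 2) * (q ^ 3) ^ ((l + 1).choose 2) =
        (q ^ 3) ^ (i.choose 2) * (q ^ 3) ^ ((l + i) * l) := by
      rw [← pow_add, ← pow_add]
      congr 1
      rw [choose_two_add, choose_two_succ]
      nlinarith [two_mul_choose_two l]
    have := pow_ne_zero ((l + i) * l) (pow_ne_zero 3 hq)
    rw [mul_div_assoc', div_eq_iff this, pow_add]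
    linear_combination ((-1) ^ i * ((q ^ 3) ^ ((l + i).choose 2) * (q ^ 3) ^ ((l + 1).choose 2))) * e
      + (-1) ^ i * f
  have B1 : ellPoch (m * b * q / q ^ (l + i)) q p (3 * l) ≠ 0 := ellPoch_ne_zero fun j _ => by
    have := hmb (1 + j - (l + i : ℕ))
    rwa [zpow_sub₀ hq, zpow_add₀ hq, zpow_one, zpow_natCast, zpow_natCast, mul_div_assoc',
      ← mul_assoc, mul_div_right_comm] at this
  have B2 : ellPoch (m * b) q p (2 * (l + i)) ≠ 0 := ellPoch_ne_zero fun j _ => by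
    have := hmb j; rwa [zpow_natCast] at this
  have B3 : ellPoch (m * q) q p (3 * (l + (L + 1)) + (l + i)) ≠ 0 := ellPoch_ne_zero fun j _ => by
    rw [mul_assoc, ← pow_succ']; exact hmj _
  have B4 : ellPoch (m * q ^ (4 * l) * q ^ i) q p (3 * L + 4) ≠ 0 := ellPoch_ne_zero fun j _ => by
    rw [mul_assoc, mul_assoc, ← pow_add, ← pow_add]; exact hmj _
  have B5 : ellPoch (m ^ 2 * b * q ^ 3) (q ^ 3) p (l + i + l) ≠ 0 := ellPoch_ne_zero fun j _ => by
    have := hkj (3 + 3 * j : ℕ)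
    rwa [zpow_natCast, pow_add, pow_mul, ← mul_assoc] at this
  have B6 : ∀ l, ellPoch (q ^ 3) (q ^ 3) p l ≠ 0 := fun l => ellPoch_ne_zero fun j _ => by
    rw [← pow_succ']; exact hQj _
  have B7 := B6 i
  have B8 := B6 (L + 1 - i)
  have A6 : ellPoch (m ^ 2 * b) (q ^ 3) p l / ellPoch (q ^ 3) (q ^ 3) p l *
        (ellPoch (m * b ^ 2) (q ^ 3) p l / ellPoch (m / b * q ^ 3) (q ^ 3) p l) =
      cubicValue q p m b l := by
    unfold cubicValue; ring
  have A7 : ellPoch (m * b * q / q ^ (l + i)) q p (3 * (l + i)) /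
      ellPoch (m * b * q / q ^ (l + i)) q p (3 * l) =
      ellPoch (m * b * q ^ (2 * l) * q / q ^ i) q p (3 * i) := by
    rw [A1]; field_simp
  have A8 : ellPoch (m * b) q p (3 * (l + (L + 1)) - (l + i)) /
      ellPoch (m * b) q p (2 * (l + i)) =
      ellPoch (m * b * q ^ (2 * l) * q ^ (2 * i)) q p (3 * (L + 1 - i)) := by
    rw [A2]; field_simp
  have A9 : ellPoch m q p (l + i) * ellPoch (m * q ^ (l + i)) q p (3 * l) /
      ellPoch (m * q) q p (3 * (l + (L + 1)) + (l + i)) =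
      ellTheta m p / ellPoch (m * q ^ (4 * l) * q ^ i) q p (3 * L + 4) := by
    rw [div_eq_div_iff B3 B4, A3]
  have A10 : ellPoch (m ^ 2 * b) (q ^ 3) p (l + (L + 1) + (l + i)) /
      ellPoch (m ^ 2 * b * q ^ 3) (q ^ 3) p (l + i + l) = ellTheta (m ^ 2 * b) p *
      ellPoch (m * q ^ (4 * l) * (m * b * q ^ (2 * l)) * (q ^ 3) ^ (i + 1)) (q ^ 3) p L := by
    rw [← A4]; field_simp
  rw [ftTerm_cubic hq hm hb, A6]
  unfold cubicFront cubicWeight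
  rw [show l + (L + 1) - (l + i) = L + 1 - i by omega, show l + i - l = i by omega,
    show m * q ^ (4 * (l + i)) = m * q ^ (4 * l) * q ^ (4 * i) by ring]
  set T := ellTheta (m * q ^ (4 * l) * q ^ (4 * i)) p
  set K := ellTheta (m ^ 2 * b * (q ^ 3) ^ (2 * l)) p
  set V := cubicValue q p m b l
  set C := ellPoch (q ^ 3) (q ^ 3) p (L + 1 - i)
  set D := ellPoch (q ^ 3) (q ^ 3) p i
  calc _ = ((-1 : ℂ) ^ (l + i) * (q ^ 3) ^ ((l + i).choose 2) *
      ((-1) ^ l * (q ^ 3) ^ ((l + 1).choose 2) / (q ^ 3) ^ ((l + i) * l))) *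
      (ellPoch (m * b * q / q ^ (l + i)) q p (3 * (l + i)) /
        ellPoch (m * b * q / q ^ (l + i)) q p (3 * l)) *
      (ellPoch (m * b) q p (3 * (l + (L + 1)) - (l + i)) / ellPoch (m * b) q p (2 * (l + i))) *
      (ellPoch m q p (l + i) * ellPoch (m * q ^ (l + i)) q p (3 * l) /
        ellPoch (m * q) q p (3 * (l + (L + 1)) + (l + i))) *
      (ellPoch (m ^ 2 * b) (q ^ 3) p (l + (L + 1) + (l + i)) /
        ellPoch (m ^ 2 * b * q ^ 3) (q ^ 3) p (l + i + l)) *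
      (T / ellTheta m p * (K / ellTheta (m ^ 2 * b) p) * V / (C * D)) := by
        simp only [div_eq_mul_inv, mul_inv]; ring
    _ = _ := by
        rw [A5, A7, A8, A9, A10]
        set W := ellPoch (m * q ^ (4 * l) * (m * b * q ^ (2 * l)) * (q ^ 3) ^ (i + 1)) (q ^ 3) p L
        set Y := ellPoch (m * q ^ (4 * l) * q ^ i) q p (3 * L + 4)
        have r1 : ellTheta m p / Y * (ellTheta (m ^ 2 * b) p * W) *
          (T / ellTheta m p * (K / ellTheta (m ^ 2 * b) p) * V / (C * D)) =
          W / Y * (T * K * V / (C * D)) := by field_simp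
        simp only [div_eq_mul_inv, mul_inv] at r1 hO ⊢
        linear_combination ((-1 : ℂ) ^ i * (q ^ 3) ^ (i.choose 2) *
          ellPoch (m * b * q ^ (2 * l) * q * (q ^ i)⁻¹) q p (3 * i) *
          ellPoch (m * b * q ^ (2 * l) * q ^ (2 * i)) q p (3 * (L + 1 - i))) * r1 +
          ((-1 : ℂ) ^ i * (q ^ 3) ^ (i.choose 2) * W * Y⁻¹ * T * K * V * C⁻¹ * D⁻¹) * hO

/-- The diagonal case `l = n`, which corresponds to no natural `L` in `cubicFront_mul_ftTerm`; it is
the only surviving contribution. -/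
theorem cubicFront_mul_ftTerm_self {p q m b : ℂ} (hq : q ≠ 0) (hm : m ≠ 0) (hb : b ≠ 0) (n : ℕ)
    (hmj : ∀ j : ℕ, ellTheta (m * q ^ j) p ≠ 0)
    (hmb : ∀ j : ℤ, ellTheta (m * b * q ^ j) p ≠ 0)
    (hkj : ∀ j : ℤ, ellTheta (m ^ 2 * b * q ^ j) p ≠ 0) :
    cubicFront q p m b n n *
      ftTerm (q ^ 3) p (m ^ 2 * b) (m * q ^ n) (m * q ^ (n + 1)) (m * q ^ (n + 2))
        (m * b ^ 2) n n = cubicValue q p m b n := by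
  have hk0 : ellTheta (m ^ 2 * b) p ≠ 0 := by simpa using hkj 0
  have hm0 : ellTheta m p ≠ 0 := by simpa using hmj 0
  have A3 : ellPoch m q p n * ellPoch (m * q ^ n) q p (3 * n) * ellTheta (m * q ^ (4 * n)) p =
      ellTheta m p * ellPoch (m * q) q p (3 * n + n) := by
    rw [← ellPoch_add, ← ellPoch_succ', show 3 * n + n = 4 * n by ring, ellPoch_succ]
    congr 2; ring
  have A4 : ellTheta (m ^ 2 * b) p * ellPoch (m ^ 2 * b * q ^ 3) (q ^ 3) p (n + n) =
      ellPoch (m ^ 2 * b) (q ^ 3) p (n + n) * ellTheta (m ^ 2 * b * (q ^ 3) ^ (2 * n)) p := by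
    rw [← ellPoch_succ', ellPoch_succ, two_mul]
  have A5 : (-1 : ℂ) ^ n * (q ^ 3) ^ (n.choose 2) *
      ((-1) ^ n * (q ^ 3) ^ ((n + 1).choose 2) / (q ^ 3) ^ (n * n)) = 1 := by
    have e : (-1 : ℂ) ^ n * (-1) ^ n = 1 := by rw [← mul_pow]; simp
    have f : (q ^ 3) ^ (n.choose 2) * (q ^ 3) ^ ((n + 1).choose 2) = (q ^ 3) ^ (n * n) := by
      rw [← pow_add]
      congr 1
      rw [choose_two_succ]
      nlinarith [two_mul_choose_two n]
    have := pow_ne_zero (n * n) (pow_ne_zero 3 hq)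
    rw [mul_div_assoc', div_eq_iff this, one_mul, ← f]
    linear_combination ((q ^ 3) ^ (n.choose 2) * (q ^ 3) ^ ((n + 1).choose 2)) * e
  have B1 : ellPoch (m * b * q / q ^ n) q p (3 * n) ≠ 0 := ellPoch_ne_zero fun j _ => by
    have := hmb (1 + j - n)
    rwa [zpow_sub₀ hq, zpow_add₀ hq, zpow_one, zpow_natCast, zpow_natCast, mul_div_assoc',
      ← mul_assoc, mul_div_right_comm] at this
  have B2 : ellPoch (m * b) q p (2 * n) ≠ 0 := ellPoch_ne_zero fun j _ => by
    have := hmb j; rwa [zpow_natCast] at this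
  have B3 : ellPoch (m * q) q p (3 * n + n) ≠ 0 := ellPoch_ne_zero fun j _ => by
    rw [mul_assoc, ← pow_succ']; exact hmj _
  have B5 : ellPoch (m ^ 2 * b * q ^ 3) (q ^ 3) p (n + n) ≠ 0 := ellPoch_ne_zero fun j _ => by
    have := hkj (3 + 3 * j : ℕ)
    rwa [zpow_natCast, pow_add, pow_mul, ← mul_assoc] at this
  have A6 : ellPoch (m ^ 2 * b) (q ^ 3) p n / ellPoch (q ^ 3) (q ^ 3) p n *
        (ellPoch (m * b ^ 2) (q ^ 3) p n / ellPoch (m / b * q ^ 3) (q ^ 3) p n) =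
      cubicValue q p m b n := by
    unfold cubicValue; ring
  rw [ftTerm_cubic hq hm hb, A6]
  unfold cubicFront
  rw [show 3 * n - n = 2 * n by omega, Nat.sub_self, ellPoch_zero]
  set V := cubicValue q p m b n
  calc _ = ((-1 : ℂ) ^ n * (q ^ 3) ^ (n.choose 2) *
      ((-1) ^ n * (q ^ 3) ^ ((n + 1).choose 2) / (q ^ 3) ^ (n * n))) *
      (ellPoch (m * b * q / q ^ n) q p (3 * n) / ellPoch (m * b * q / q ^ n) q p (3 * n)) *
      (ellPoch (m * b) q p (2 * n) / ellPoch (m * b) q p (2 * n)) *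
      ((ellPoch m q p n * ellPoch (m * q ^ n) q p (3 * n) * ellTheta (m * q ^ (4 * n)) p) /
        (ellTheta m p * ellPoch (m * q) q p (3 * n + n))) *
      ((ellPoch (m ^ 2 * b) (q ^ 3) p (n + n) * ellTheta (m ^ 2 * b * (q ^ 3) ^ (2 * n)) p) /
        (ellTheta (m ^ 2 * b) p * ellPoch (m ^ 2 * b * q ^ 3) (q ^ 3) p (n + n))) * V := by
        simp only [div_eq_mul_inv, mul_inv, inv_one]; ring
    _ = V := by
        rw [A5, A3, ← A4, div_self B1, div_self B2, div_self (mul_ne_zero hm0 B3),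
          div_self (mul_ne_zero hk0 B5)]
        ring

/-- The cubic sum for generic `b`. -/
theorem cubic_sum_generic {p : ℂ} (hp : ‖p‖ < 1) {q m b : ℂ} (hq : q ≠ 0) (hm : m ≠ 0)
    (hb : b ≠ 0) (n : ℕ)
    (hQj : ∀ j : ℕ, ellTheta ((q ^ 3) ^ (j + 1)) p ≠ 0)
    (hmj : ∀ j : ℕ, ellTheta (m * q ^ j) p ≠ 0)
    (hmb : ∀ j : ℤ, ellTheta (m * b * q ^ j) p ≠ 0)
    (hkj : ∀ j : ℤ, ellTheta (m ^ 2 * b * q ^ j) p ≠ 0)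
    (hej : ∀ j : ℤ, ellTheta (m * b ^ 2 * q ^ j) p ≠ 0)
    (haj : ∀ j : ℤ, ellTheta (m / b * q ^ j) p ≠ 0) :
    ∑ r ∈ range (n + 1), cubicTerm q p m b n r = cubicValue q p m b n := by
  have hz : ∀ (x : ℂ) (j : ℤ), x * (q ^ 3) ^ j = x * q ^ (3 * j) := fun x j => by
    rw [zpow_mul, zpow_ofNat]
  have hFT : ∀ r, cubicTerm q p m b n r = ∑ l ∈ range (r + 1), cubicFront q p m b n r *
      ftTerm (q ^ 3) p (m ^ 2 * b) (m * q ^ r) (m * q ^ (r + 1)) (m * q ^ (r + 2))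
        (m * b ^ 2) r l := by
    intro r
    have key : ∀ s : ℕ, ∀ j : ℕ,
        ellTheta (m ^ 2 * b * (q ^ 3) ^ (j + 1) / (m * q ^ (r + s))) p ≠ 0 := by
      intro s j
      have := hmb ((3 * (j + 1) : ℕ) - (r + s : ℕ))
      rw [zpow_sub₀ hq, zpow_natCast, zpow_natCast] at this
      rwa [show m ^ 2 * b * (q ^ 3) ^ (j + 1) / (m * q ^ (r + s)) =
        m * b * (q ^ (3 * (j + 1)) / q ^ (r + s)) by field_simp; ring]
    rw [← mul_sum, frenkel_turaev hp (pow_ne_zero 3 hq) hQj r (a := m ^ 2 * b) (b := m * q ^ r)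
      (c := m * q ^ (r + 1)) (d := m * q ^ (r + 2)) (e := m * b ^ 2) (by simp [*]) (by simp [*])
      (by simp [*]) (by simp [*]) (by simp [*]) (by ring) ?_ (by simpa using key 0) (key 1) (key 2) ?_ ?_]
    · refine cubicTerm_eq hp hq hm hb (ellPoch_ne_zero fun j _ => ?_)
      have := hmb (1 + j - r)
      rwa [zpow_sub₀ hq, zpow_add₀ hq, zpow_one, zpow_natCast, zpow_natCast, mul_div_assoc',
        ← mul_assoc, mul_div_right_comm] at this
    · intro j
      have := hkj (3 * j)
      rwa [← hz, zpow_natCast] at this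
    · intro j; rw [hz]; exact hej _
    · intro j
      rw [hz, show m ^ 2 * b / (m * b ^ 2) = m / b by field_simp]; exact haj _
  -- Interchange the sums over the triangle `l ≤ r ≤ n`, with `r = l + i`.
  rw [sum_congr rfl fun r _ => hFT r, sum_sigma',
    sum_bij' (t := (range (n + 1)).sigma fun l => range (n + 1 - l))
      (g := fun x => cubicFront q p m b n (x.1 + x.2) *
        ftTerm (q ^ 3) p (m ^ 2 * b) (m * q ^ (x.1 + x.2)) (m * q ^ (x.1 + x.2 + 1))
          (m * q ^ (x.1 + x.2 + 2)) (m * b ^ 2) (x.1 + x.2) x.1)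
      (fun x _ => ⟨x.2, x.1 - x.2⟩) (fun x _ => ⟨x.1 + x.2, x.1⟩)]
  · rw [sum_sigma, sum_range_succ, sum_eq_zero, zero_add]
    · simp only [Nat.add_sub_cancel_left, sum_range_one, add_zero]
      exact cubicFront_mul_ftTerm_self hq hm hb n hmj hmb hkj
    · intro l hl
      obtain ⟨L, rfl⟩ := Nat.exists_eq_add_of_lt (mem_range.1 hl)
      rw [show l + L + 1 + 1 - l = L + 2 by omega, add_assoc]
      have hO := cubic_orthogonality hp (M := m * q ^ (4 * l)) (g := m * b * q ^ (2 * l)) hq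
        (by simp [*]) (by simp [*]) L hQj (fun j => by rw [mul_assoc, ← pow_add]; exact hmj _) (by
          have := hkj (6 * l + 3 * (L + 1) : ℕ)
          rw [zpow_natCast] at this
          rwa [show m * q ^ (4 * l) * (m * b * q ^ (2 * l)) * (q ^ 3) ^ (L + 1) =
            m ^ 2 * b * q ^ (6 * l + 3 * (L + 1)) by ring])
      rw [sum_congr rfl fun i hi => cubicFront_mul_ftTerm hq hm hb
        (Nat.lt_succ_iff.1 (mem_range.1 hi)) hQj hmj hmb hkj, ← mul_sum, hO, mul_zero]
  · simp only [mem_sigma, mem_range]; intro x hx; omega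
  · simp only [mem_sigma, mem_range]; intro x hx; omega
  · rintro ⟨r, l⟩ hx
    simp only [mem_sigma, mem_range] at hx
    simp only [Sigma.mk.injEq, heq_eq_eq, and_true]; omega
  · rintro ⟨l, i⟩ hx
    simp only [Nat.add_sub_cancel_left]
  · rintro ⟨r, l⟩ hx
    simp only [mem_sigma, mem_range] at hx
    have : l + (r - l) = r := by omega
    simp only [this]

section

open Filter Topology

/-! ### The cubic summation -/

theorem continuousAt_ellPoch {p : ℂ} (hp : ‖p‖ < 1) {q : ℂ} (hq : q ≠ 0) {f : ℂ → ℂ} {x : ℂ}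
    (hf : ContinuousAt f x) (h0 : f x ≠ 0) (n : ℕ) :
    ContinuousAt (fun w => ellPoch (f w) q p n) x := by
  unfold ellPoch
  refine tendsto_finsetProd _ fun j _ => ?_
  exact ContinuousAt.comp (f := fun w => f w * q ^ j) (g := fun w => ellTheta w p)
    (continuousAt_ellTheta hp (mul_ne_zero h0 (pow_ne_zero j hq))) (hf.mul continuousAt_const)

theorem countable_sq_preimage {S : Set ℂ} (hS : S.Countable) : {b : ℂ | b ^ 2 ∈ S}.Countable := by
  have : {b : ℂ | b ^ 2 ∈ S} = ⋃ s ∈ S, {b : ℂ | b ^ 2 = s} := by ext b; simp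
  rw [this]
  refine hS.biUnion fun s _ => ?_
  obtain ⟨t, ht⟩ := IsAlgClosed.exists_pow_nat_eq s two_pos
  refine (Set.Finite.subset (Set.toFinite {t, -t}) fun b hb => ?_).countable
  have hb' : b ^ 2 = t ^ 2 := by rw [ht]; exact hb
  simpa using sq_eq_sq_iff_eq_or_eq_neg.1 hb'

theorem countable_setOf_exists_zero {p : ℂ} (hp : ‖p‖ < 1) {q c : ℂ} (hq : q ≠ 0) (hc : c ≠ 0) :
    {b : ℂ | b ≠ 0 ∧ ∃ j : ℤ, ellTheta (c * b * q ^ j) p = 0}.Countable := by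
  have : {b : ℂ | b ≠ 0 ∧ ∃ j : ℤ, ellTheta (c * b * q ^ j) p = 0} ⊆
      ⋃ j : ℤ, (fun z => z / (c * q ^ j)) '' {z : ℂ | z ≠ 0 ∧ ellTheta z p = 0} := by
    rintro b ⟨hb, j, hj⟩
    have := zpow_ne_zero j hq
    exact Set.mem_iUnion.2 ⟨j, c * b * q ^ j, ⟨by simp [*], hj⟩, by field_simp⟩
  exact (Set.countable_iUnion fun j => (countable_ellTheta_zeros hp).image _).mono this

/-- The cubic elliptic summation. -/
theorem cubic_sum {p : ℂ} (hp : ‖p‖ < 1) {q m b : ℂ} (hq : q ≠ 0) (hm : m ≠ 0)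
    (hb : b ≠ 0) (n : ℕ)
    (hQj : ∀ j : ℕ, ellTheta ((q ^ 3) ^ (j + 1)) p ≠ 0)
    (hmj : ∀ j : ℕ, ellTheta (m * q ^ j) p ≠ 0)
    (hmb : ∀ j : ℕ, ellTheta (m * b * q ^ j) p ≠ 0)
    (haj : ∀ j : ℕ, ellTheta (m / b * (q ^ 3) ^ (j + 1)) p ≠ 0) :
    ∑ r ∈ range (n + 1), cubicTerm q p m b n r = cubicValue q p m b n := by
  have hQ := pow_ne_zero 3 hq
  have cM := countable_setOf_exists_zero hp hq hm
  have cK := countable_setOf_exists_zero hp hq (pow_ne_zero 2 hm)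
  have cA := countable_setOf_exists_zero hp hq (inv_ne_zero hm)
  have cE := countable_sq_preimage cM
  -- The values excluded by the generic version form a countable set, so the admissible ones are
  -- dense.
  have hd := (((((cM.union cK).union cA).union cE).union (Set.countable_singleton 0)).dense_compl ℂ)
  have hgen : ∃ᶠ w in 𝓝 b, ∑ r ∈ range (n + 1), cubicTerm q p m w n r = cubicValue q p m w n := by
    refine (mem_closure_iff_frequently.1 (hd b)).mono fun w hw => ?_
    simp only [Set.mem_compl_iff, Set.mem_union, Set.mem_ofPred_eq, Set.mem_singleton_iff, not_or,
      not_and, not_exists] at hw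
    obtain ⟨⟨⟨⟨h1, h2⟩, h3⟩, h4⟩, h0⟩ := hw
    refine cubic_sum_generic hp hq hm h0 n hQj hmj (h1 h0) (h2 h0) (h4 (pow_ne_zero 2 h0)) ?_
    intro j hj
    have hqj := zpow_ne_zero j hq
    refine h3 h0 (-j) ?_
    -- The condition on `m / w` is that on `m⁻¹ * w`, by inversion of the theta argument.
    rw [zpow_neg, ellTheta_of_mul_eq_one hp (x := m / w * q ^ j) (by simp [*]), hj]
    · simp
    · field_simp
  -- For continuity at `b`, only the denominators that vary with `b` must be nonzero there.
  have nQ : ∀ l, ellPoch (q ^ 3) (q ^ 3) p l ≠ 0 := fun l => ellPoch_ne_zero fun j _ => by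
    rw [← pow_succ']; exact hQj _
  have nA : ∀ l, ellPoch (m / b * q ^ 3) (q ^ 3) p l ≠ 0 := fun l => ellPoch_ne_zero fun j _ => by
    rw [mul_assoc, ← pow_succ']; exact haj _
  have nB : ∀ l, ellPoch (m * b) q p l ≠ 0 := fun l => ellPoch_ne_zero fun j _ => hmb j
  have c1 : ∀ l, ContinuousAt (fun w => ellPoch (m / w * q ^ 3) (q ^ 3) p l) b := fun l =>
    continuousAt_ellPoch hp hQ (by fun_prop (disch := assumption)) (by simp [*]) l
  have c2 : ∀ l, ContinuousAt (fun w => ellPoch (m * w) q p l) b := fun l =>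
    continuousAt_ellPoch hp hq (by fun_prop) (by simp [*]) l
  have c3 : ∀ l, ContinuousAt (fun w => ellPoch w q p l) b := fun l =>
    continuousAt_ellPoch hp hq continuousAt_id hb l
  have c4 : ∀ l, ContinuousAt (fun w => ellPoch (q / w) q p l) b := fun l =>
    continuousAt_ellPoch hp hq (by fun_prop (disch := assumption)) (by simp [*]) l
  have c5 : ∀ l, ContinuousAt (fun w => ellPoch (m ^ 2 * w) (q ^ 3) p l) b := fun l =>
    continuousAt_ellPoch hp hQ (by fun_prop) (by simp [*]) l
  have c6 : ∀ l, ContinuousAt (fun w => ellPoch (m * w ^ 2) (q ^ 3) p l) b := fun l =>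
    continuousAt_ellPoch hp hQ (by fun_prop) (by simp [*]) l
  refine tendsto_nhds_unique_of_frequently_eq (l := 𝓝 b)
    (f := fun w => ∑ r ∈ range (n + 1), cubicTerm q p m w n r)
    (g := fun w => cubicValue q p m w n) ?_ ?_ hgen
  · refine tendsto_finsetSum _ fun r _ => ?_
    change ContinuousAt (fun w => cubicTerm q p m w n r) b
    unfold cubicTerm
    refine ContinuousAt.mul (ContinuousAt.mul (ContinuousAt.mul (ContinuousAt.mul
      (continuousAt_const.mul ((c4 _).div (c2 _) (nB _))) ((c2 _).div_const _))
      ((c5 _).div_const _)) (by fun_prop))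
      (((c3 _).div_const _).mul (continuousAt_const.div (c1 _) (nA _)))
  · change ContinuousAt (fun w => cubicValue q p m w n) b
    unfold cubicValue
    exact ((c6 _).div_const _).mul ((c5 _).div (c1 _) (nA _))

end

/-! ### From the cubic sum to the Bailey pair -/

theorem ellFac_natCast (x q p : ℂ) (n : ℕ) : ellFac x q p (n : ℤ) = ellPoch x q p n := rfl

theorem ellFac_eq_ellPoch {x q p : ℂ} {z : ℤ} (n : ℕ) (h : z = n) :
    ellFac x q p z = ellPoch x q p n := by rw [h, ellFac_natCast]

theorem ellPoch_div_pow {x q p : ℂ} (hq : q ≠ 0) (n : ℕ) :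
    ellPoch (x / q ^ n) q p n = ∏ j ∈ range n, ellTheta (x / q ^ (j + 1)) p := by
  induction n with
  | zero => simp
  | succ n ih =>
    rw [ellPoch_succ', prod_range_succ, ← ih,
      show x / q ^ (n + 1) * q = x / q ^ n by field_simp; ring, mul_comm]

/-- One quotient formula for indices of either sign; it is needed because `r - 3 * s` may be
negative. -/
theorem ellFac_sub {x q p : ℂ} (hq : q ≠ 0) (u v : ℕ) (h : ellPoch (x / q ^ v) q p v ≠ 0) :
    ellFac x q p ((u : ℤ) - v) = ellPoch (x / q ^ v) q p u / ellPoch (x / q ^ v) q p v := by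
  rcases Nat.lt_or_ge u v with huv | huv
  · obtain ⟨w, rfl⟩ := Nat.exists_eq_add_of_lt huv
    have e : (u : ℤ) - ((u + w + 1 : ℕ) : ℤ) = Int.negSucc w := by
      rw [Int.negSucc_eq]; push_cast; ring
    rw [add_assoc, ellPoch_add] at h
    have h1 := left_ne_zero_of_mul h
    rw [e, add_assoc, ellPoch_add, show x / q ^ (u + (w + 1)) * q ^ u = x / q ^ (w + 1) by
      rw [pow_add]; field_simp, ellPoch_div_pow hq (w + 1)]
    rw [div_mul_eq_div_div, div_self h1, one_div]
    rfl
  · obtain ⟨w, rfl⟩ := Nat.exists_eq_add_of_le huv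
    rw [ellPoch_add, show x / q ^ v * q ^ v = x by field_simp,
      show ((v + w : ℕ) : ℤ) - v = w by push_cast; ring, ellFac_natCast]
    field_simp

/-- The coefficient of `A s` in the `r`-th summand of `β n`. -/
noncomputable def cubicCoeff (q p m b : ℂ) (n r s : ℕ) : ℂ :=
  ellTheta (m * q ^ (4 * r)) p / ellTheta m p *
    (ellPoch (q / b) q p (2 * r) / ellPoch (m * b) q p (2 * r)) *
    (ellPoch (m * b) q p (3 * n - r) / ellPoch (q ^ 3) (q ^ 3) p (n - r)) *
    (ellPoch (m ^ 2 * b) (q ^ 3) p (n + r) / ellPoch (m * q) q p (3 * n + r)) *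
    (q ^ (2 * r.choose 2) * (m * b) ^ r) *
    (ellFac b q p ((r : ℤ) - (3 * s : ℕ)) / ellPoch (q ^ 3) (q ^ 3) p (r - s) *
      (ellPoch m q p (r + 3 * s) / ellPoch (m / b * q ^ 3) (q ^ 3) p (r + s)))

/-- Peel from each product the factors common to all `i`; what is left has `m * q ^ (4 * s)` and `b
/ q ^ (2 * s)` in place of `m` and `b`. Since `s + i - 3 * s = i - 2 * s`, the symbol `(b)_(r-3s)`
starts at `b / q ^ (2 * s)`. -/
theorem cubicCoeff_eq {p : ℂ} (hp : ‖p‖ < 1) {q m b : ℂ} (hq : q ≠ 0) (hm : m ≠ 0) (hb : b ≠ 0)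
    (hmj : ∀ j : ℕ, ellTheta (m * q ^ j) p ≠ 0)
    (hmb : ∀ j : ℕ, ellTheta (m * b * q ^ j) p ≠ 0)
    (hbj : ∀ j : ℕ, ellTheta (b / q ^ (j + 1)) p ≠ 0) {s N i : ℕ} (hi : i ≤ N) :
    cubicCoeff q p m b (s + N) (s + i) s =
      q ^ (3 * s ^ 2) * (m / b) ^ s *
        (ellPoch (m ^ 2 * b) (q ^ 3) p (2 * s) / ellPoch (m / b * q ^ 3) (q ^ 3) p (2 * s)) *
        cubicTerm q p (m * q ^ (4 * s)) (b / q ^ (2 * s)) N i := by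
  have nb : ellPoch (b / q ^ (2 * s)) q p (2 * s) ≠ 0 := by
    rw [ellPoch_div_pow hq]; exact prod_ne_zero_iff.2 fun j _ => hbj j
  have hrev := ellPoch_reverse hp hb hq (2 * s)
  have nq : ellPoch (q / b) q p (2 * s) ≠ 0 := fun h => nb (by rw [hrev, h, zero_mul])
  have nmb : ellPoch (m * b) q p (2 * s) ≠ 0 := ellPoch_ne_zero fun j _ => hmb j
  have nm : ellTheta m p ≠ 0 := by simpa using hmj 0
  have nm4 := hmj (4 * s)
  have nP : ellPoch m q p (4 * s) ≠ 0 := ellPoch_ne_zero fun j _ => hmj j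
  have nPq : ellPoch (m * q) q p (4 * s) ≠ 0 := ellPoch_ne_zero fun j _ => by
    rw [mul_assoc, ← pow_succ']; exact hmj _
  have hq2 := pow_ne_zero (2 * s) hq
  have C : (2 * s + 1).choose 2 = 2 * s ^ 2 + s := by
    rw [Nat.choose_two_right, Nat.add_sub_cancel]
    exact Nat.div_eq_of_eq_mul_left two_pos (by ring)
  rw [C] at hrev
  have e0 : ellFac b q p (((s + i : ℕ) : ℤ) - (3 * s : ℕ)) =
      ellPoch (b / q ^ (2 * s)) q p i / ellPoch (b / q ^ (2 * s)) q p (2 * s) := by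
    rw [← ellFac_sub hq _ _ nb]
    congr 1; push_cast; ring
  have e1 : ellPoch (q / b) q p (2 * (s + i)) =
      ellPoch (q / b) q p (2 * s) * ellPoch (q / (b / q ^ (2 * s))) q p (2 * i) := by
    rw [mul_add, ellPoch_add, show q / b * q ^ (2 * s) = q / (b / q ^ (2 * s)) by field_simp]
  have g1 : m * b * q ^ (2 * s) = m * q ^ (4 * s) * (b / q ^ (2 * s)) := by field_simp; ring
  have e2 : ellPoch (m * b) q p (2 * (s + i)) = ellPoch (m * b) q p (2 * s) *
      ellPoch (m * q ^ (4 * s) * (b / q ^ (2 * s))) q p (2 * i) := by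
    rw [mul_add, ellPoch_add, g1]
  have e3 : ellPoch (m * b) q p (3 * (s + N) - (s + i)) = ellPoch (m * b) q p (2 * s) *
      ellPoch (m * q ^ (4 * s) * (b / q ^ (2 * s))) q p (3 * N - i) := by
    rw [show 3 * (s + N) - (s + i) = 2 * s + (3 * N - i) by omega, ellPoch_add, g1]
  have e4 : ellPoch (m ^ 2 * b) (q ^ 3) p (s + N + (s + i)) =
      ellPoch (m ^ 2 * b) (q ^ 3) p (2 * s) *
        ellPoch ((m * q ^ (4 * s)) ^ 2 * (b / q ^ (2 * s))) (q ^ 3) p (N + i) := by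
    rw [show s + N + (s + i) = 2 * s + (N + i) by ring, ellPoch_add,
      show m ^ 2 * b * (q ^ 3) ^ (2 * s) = (m * q ^ (4 * s)) ^ 2 * (b / q ^ (2 * s)) by
        field_simp; ring]
  have e5 : ellPoch (m * q) q p (3 * (s + N) + (s + i)) = ellPoch (m * q) q p (4 * s) *
      ellPoch (m * q ^ (4 * s) * q) q p (3 * N + i) := by
    rw [show 3 * (s + N) + (s + i) = 4 * s + (3 * N + i) by ring, ellPoch_add,
      mul_right_comm m q]
  have e6 : ellPoch m q p (s + i + 3 * s) =
      ellPoch m q p (4 * s) * ellPoch (m * q ^ (4 * s)) q p i := by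
    rw [show s + i + 3 * s = 4 * s + i by ring, ellPoch_add]
  have e7 : ellPoch (m / b * q ^ 3) (q ^ 3) p (s + i + s) =
      ellPoch (m / b * q ^ 3) (q ^ 3) p (2 * s) *
        ellPoch (m * q ^ (4 * s) / (b / q ^ (2 * s)) * q ^ 3) (q ^ 3) p i := by
    rw [show s + i + s = 2 * s + i by ring, ellPoch_add,
      show m / b * q ^ 3 * (q ^ 3) ^ (2 * s) = m * q ^ (4 * s) / (b / q ^ (2 * s)) * q ^ 3 by
        field_simp; ring]
  have e8 : ellPoch m q p (4 * s) * ellTheta (m * q ^ (4 * s)) p =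
      ellTheta m p * ellPoch (m * q) q p (4 * s) := by
    rw [← ellPoch_succ, ellPoch_succ']
  have e9 : q ^ (2 * (s + i).choose 2) * (m * b) ^ (s + i) =
      q ^ (2 * s.choose 2) * (m * b) ^ s *
        (q ^ (2 * i.choose 2) * (m * q ^ (4 * s) * (b / q ^ (2 * s))) ^ i) := by
    rw [choose_two_add, ← g1]; ring
  -- Reversing `(b / q^(2s); q)_(2s)` produces the monomial that accounts for `q ^ (3 * s ^ 2)` and
  -- for `a ^ s = (m / b) ^ s`.
  have e10 : q ^ (3 * s ^ 2) * (m / b) ^ s * ((-b) ^ (2 * s) / q ^ (2 * s ^ 2 + s)) =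
      q ^ (2 * s.choose 2) * (m * b) ^ s := by
    have := two_mul_choose_two s
    rw [show 3 * s ^ 2 = 2 * s.choose 2 + (2 * s ^ 2 + s) by nlinarith, pow_add, pow_mul (-b),
      neg_sq]
    have h1 := pow_ne_zero (2 * s ^ 2 + s) hq
    field_simp
    rw [← mul_pow]; congr 1; field_simp
  unfold cubicCoeff cubicTerm
  rw [e0, e1, e2, e3, e4, e5, e6, e7, e9, hrev, ← e10,
    show s + N - (s + i) = N - i by omega, Nat.add_sub_cancel_left,
    show m * q ^ (4 * (s + i)) = m * q ^ (4 * s) * q ^ (4 * i) by ring]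
  have nB : (-b) ^ (2 * s) / q ^ (2 * s ^ 2 + s) ≠ 0 := by simp [*]
  generalize (-b) ^ (2 * s) / q ^ (2 * s ^ 2 + s) = R at *
  have E : ellPoch m q p (4 * s) / (ellTheta m p * ellPoch (m * q) q p (4 * s)) =
      1 / ellTheta (m * q ^ (4 * s)) p := by
    rw [← e8]; field_simp
  generalize ellTheta (m * q ^ (4 * s) * q ^ (4 * i)) p = a1 at *
  generalize ellPoch (q / (b / q ^ (2 * s))) q p (2 * i) = a2 at *
  generalize ellPoch (m * q ^ (4 * s) * (b / q ^ (2 * s))) q p (2 * i) = a3 at *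
  generalize ellPoch (m * q ^ (4 * s) * (b / q ^ (2 * s))) q p (3 * N - i) = a4 at *
  generalize ellPoch ((m * q ^ (4 * s)) ^ 2 * (b / q ^ (2 * s))) (q ^ 3) p (N + i) = a5 at *
  generalize ellPoch (m * q ^ (4 * s) * q) q p (3 * N + i) = a6 at *
  generalize ellPoch (m * q ^ (4 * s)) q p i = a7 at *
  generalize ellPoch (m * q ^ (4 * s) / (b / q ^ (2 * s)) * q ^ 3) (q ^ 3) p i = a8 at *
  generalize q ^ (2 * i.choose 2) * (m * q ^ (4 * s) * (b / q ^ (2 * s))) ^ i = a9 at *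
  generalize ellPoch (b / q ^ (2 * s)) q p i = b1 at *
  generalize ellPoch (q ^ 3) (q ^ 3) p (N - i) = b2 at *
  generalize ellPoch (q ^ 3) (q ^ 3) p i = b3 at *
  generalize ellPoch (m ^ 2 * b) (q ^ 3) p (2 * s) = b4 at *
  generalize ellPoch (m / b * q ^ 3) (q ^ 3) p (2 * s) = b5 at *
  generalize ellPoch (q / b) q p (2 * s) = b6 at *
  generalize ellPoch (m * b) q p (2 * s) = b7 at *
  generalize q ^ (3 * s ^ 2) * (m / b) ^ s = b8 at *
  calc _ = (ellPoch m q p (4 * s) / (ellTheta m p * ellPoch (m * q) q p (4 * s))) *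
      (b6 / b6) * (b7 / b7) * (R / R) *
      (a1 * a2 / a3 * a4 / b2 * (b4 * a5 / a6) * b8 * a9 * (b1 / b3) * (a7 / (b5 * a8))) := by
        simp only [div_eq_mul_inv, mul_inv]; ring
    _ = _ := by
        rw [E, div_self nq, div_self nmb, div_self nB]
        simp only [div_eq_mul_inv, mul_inv]; ring

/-- Summation of the coefficients of `A s` in `β n`. -/
theorem sum_cubicCoeff {p : ℂ} (hp : ‖p‖ < 1) {q m b : ℂ} (hq : q ≠ 0) (hm : m ≠ 0) (hb : b ≠ 0)
    (hQj : ∀ j : ℕ, ellTheta ((q ^ 3) ^ (j + 1)) p ≠ 0)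
    (hmj : ∀ j : ℕ, ellTheta (m * q ^ j) p ≠ 0)
    (hmb : ∀ j : ℕ, ellTheta (m * b * q ^ j) p ≠ 0)
    (hbj : ∀ j : ℕ, ellTheta (b / q ^ (j + 1)) p ≠ 0)
    (haj : ∀ j : ℕ, ellTheta (m / b * (q ^ 3) ^ (j + 1)) p ≠ 0) (s N : ℕ) :
    ∑ i ∈ range (N + 1), cubicCoeff q p m b (s + N) (s + i) s =
      ellPoch (m * b ^ 2) (q ^ 3) p N / ellPoch (q ^ 3) (q ^ 3) p N *
      (ellPoch (m ^ 2 * b) (q ^ 3) p (s + N + s) /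
        ellPoch (m / b * q ^ 3) (q ^ 3) p (s + N + s)) *
      (q ^ (3 * s ^ 2) * (m / b) ^ s) := by
  have hq2 := pow_ne_zero (2 * s) hq
  have g1 : m * q ^ (4 * s) * (b / q ^ (2 * s)) = m * b * q ^ (2 * s) := by field_simp; ring
  have g2 : m * q ^ (4 * s) / (b / q ^ (2 * s)) = m / b * (q ^ 3) ^ (2 * s) := by field_simp; ring
  rw [sum_congr rfl fun i hi => cubicCoeff_eq hp hq hm hb hmj hmb hbj
    (Nat.lt_succ_iff.1 (mem_range.1 hi)), ← mul_sum, cubic_sum hp hq (by simp [*]) (by simp [*]) N hQj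
    (fun j => by rw [mul_assoc, ← pow_add]; exact hmj _)
    (fun j => by rw [g1, mul_assoc, ← pow_add]; exact hmb _)
    (fun j => by rw [g2, mul_assoc, ← pow_add]; exact haj _)]
  unfold cubicValue
  rw [show m * q ^ (4 * s) * (b / q ^ (2 * s)) ^ 2 = m * b ^ 2 by field_simp; ring,
    show (m * q ^ (4 * s)) ^ 2 * (b / q ^ (2 * s)) = m ^ 2 * b * (q ^ 3) ^ (2 * s) by
      field_simp; ring, g2,
    show s + N + s = 2 * s + N by ring, ellPoch_add (m ^ 2 * b), ellPoch_add (m / b * q ^ 3),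
    mul_right_comm (m / b) (q ^ 3)]
  simp only [div_eq_mul_inv, mul_inv]
  ring

theorem theorem5p4 (a k m q p : ℂ) (hp : ‖p‖ < 1)
    (ha : a ≠ 0) (hm : m ≠ 0) (hq : q ≠ 0) (hmak : m ^ 3 = a * k)
    -- none of the denominators that occur vanishes
    (h1 : ∀ j : ℕ, 1 ≤ j → ellTheta (q ^ (3 * j)) p ≠ 0)
    (h2 : ∀ j : ℕ, 1 ≤ j → ellTheta (a * q ^ (3 * j)) p ≠ 0)
    (h3 : ∀ j : ℕ, ellTheta (m * q ^ j) p ≠ 0)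
    (h4 : ∀ j : ℕ, ellTheta (m ^ 2 / a * q ^ j) p ≠ 0)
    (h5 : ∀ j : ℕ, 1 ≤ j → ellTheta (m / a / q ^ j) p ≠ 0)
    (A B α β : ℕ → ℂ)
    (hAB : IsBibasicEllipticWPBaileyPair 3 a m q p A B)
    (hα : ∀ n : ℕ, α n = q ^ (3 * n ^ 2) * a ^ n * A n)
    (hβ : ∀ n : ℕ, β n = ∑ r ∈ Finset.range (n + 1),
      ellTheta (m * q ^ (4 * r)) p / ellTheta m p *
      (ellFac (a * q / m) q p (2 * (r : ℤ)) / ellFac (m ^ 2 / a) q p (2 * (r : ℤ))) *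
      (ellFac (k / m) q p (3 * (n : ℤ) - r) / ellFac (q ^ 3) (q ^ 3) p ((n : ℤ) - r)) *
      (ellFac k (q ^ 3) p ((n : ℤ) + r) / ellFac (m * q) q p (3 * (n : ℤ) + r)) *
      q ^ (2 * r.choose 2) * (k / m) ^ r * B r) :
    IsEllipticWPBaileyPair a k (q ^ 3) p α β := by
  obtain ⟨b, hb, rfl⟩ : ∃ b, b ≠ 0 ∧ a = m / b := ⟨m / a, div_ne_zero hm ha, by field_simp⟩
  obtain rfl : k = m ^ 2 * b := by
    have : m ^ 3 * b = m * k := by rw [hmak]; field_simp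
    refine mul_left_cancel₀ hm ?_
    rw [← this]; ring
  have f1 : m ^ 2 * b / (m / b) = m * b ^ 2 := by field_simp
  have f2 : m / (m / b) = b := by field_simp
  have f3 : m ^ 2 / (m / b) = m * b := by field_simp
  have f4 : m / b * q / m = q / b := by field_simp
  have f5 : m ^ 2 * b / m = m * b := by field_simp
  simp only [f2] at h5
  simp only [f3] at h4
  have hQj : ∀ j : ℕ, ellTheta ((q ^ 3) ^ (j + 1)) p ≠ 0 := fun j => by
    rw [← pow_mul]; exact h1 (j + 1) (Nat.le_add_left 1 j)
  have haj : ∀ j : ℕ, ellTheta (m / b * (q ^ 3) ^ (j + 1)) p ≠ 0 := fun j => by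
    rw [← pow_mul]; exact h2 (j + 1) (Nat.le_add_left 1 j)
  have hbj : ∀ j : ℕ, ellTheta (b / q ^ (j + 1)) p ≠ 0 := fun j => h5 (j + 1) (Nat.le_add_left 1 j)
  intro n
  have hterm : ∀ r ∈ range (n + 1), ellTheta (m * q ^ (4 * r)) p / ellTheta m p *
      (ellFac (m / b * q / m) q p (2 * (r : ℤ)) / ellFac (m ^ 2 / (m / b)) q p (2 * (r : ℤ))) *
      (ellFac (m ^ 2 * b / m) q p (3 * (n : ℤ) - r) / ellFac (q ^ 3) (q ^ 3) p ((n : ℤ) - r)) *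
      (ellFac (m ^ 2 * b) (q ^ 3) p ((n : ℤ) + r) / ellFac (m * q) q p (3 * (n : ℤ) + r)) *
      q ^ (2 * r.choose 2) * (m ^ 2 * b / m) ^ r * B r =
      ∑ s ∈ range (r + 1), cubicCoeff q p m b n r s * A s := by
    intro r hr
    have hrn : r ≤ n := Nat.lt_succ_iff.1 (mem_range.1 hr)
    rw [hAB r, mul_sum]
    refine sum_congr rfl fun s hs => ?_
    have hsr : s ≤ r := Nat.lt_succ_iff.1 (mem_range.1 hs)
    -- All indices are natural because `s ≤ r ≤ n`, except `r - 3 * s`, which stays an integer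
    -- index.
    rw [f2, f3, f4, f5, ellFac_eq_ellPoch (2 * r) (by push_cast; ring),
      ellFac_eq_ellPoch (2 * r) (by push_cast; ring),
      ellFac_eq_ellPoch (3 * n - r) (by omega), ellFac_eq_ellPoch (n - r) (by omega),
      ellFac_eq_ellPoch (n + r) (by push_cast; ring),
      ellFac_eq_ellPoch (3 * n + r) (by push_cast; ring),
      ellFac_eq_ellPoch (z := (r : ℤ) - s) (r - s) (by omega),
      ellFac_eq_ellPoch (z := (r : ℤ) + (3 : ℕ) * s) (r + 3 * s) (by push_cast; ring),
      ellFac_eq_ellPoch (z := (r : ℤ) + s) (r + s) (by push_cast; ring)]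
    unfold cubicCoeff
    push_cast
    ring
  -- Interchange the sums over `s ≤ r ≤ n` with `r = s + i`; `sum_cubicCoeff` then evaluates the
  -- coefficient of each `A s`.
  rw [hβ n, sum_congr rfl hterm, sum_sigma',
    sum_bij' (t := (range (n + 1)).sigma fun s => range (n - s + 1))
      (g := fun x => cubicCoeff q p m b n (x.1 + x.2) x.1 * A x.1)
      (fun x _ => ⟨x.2, x.1 - x.2⟩) (fun x _ => ⟨x.1 + x.2, x.1⟩)]
  · rw [sum_sigma]
    refine sum_congr rfl fun s hs => ?_
    obtain ⟨N, rfl⟩ := Nat.exists_eq_add_of_le (Nat.lt_succ_iff.1 (mem_range.1 hs))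
    rw [Nat.add_sub_cancel_left]
    dsimp only
    rw [← sum_mul,
      sum_cubicCoeff hp hq hm hb hQj h3 h4 hbj haj, f1, hα s,
      ellFac_eq_ellPoch N (by push_cast; ring), ellFac_eq_ellPoch N (by push_cast; ring),
      ellFac_eq_ellPoch (s + N + s) (by push_cast; ring),
      ellFac_eq_ellPoch (s + N + s) (by push_cast; ring)]
    ring
  · simp only [mem_sigma, mem_range]; intro x hx; omega
  · simp only [mem_sigma, mem_range]; intro x hx; omega
  · rintro ⟨r, s⟩ hx
    simp only [mem_sigma, mem_range] at hx
    simp only [Sigma.mk.injEq, heq_eq_eq, and_true]; omega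
  · rintro ⟨s, i⟩ hx
    simp only [Nat.add_sub_cancel_left]
  · rintro ⟨r, s⟩ hx
    simp only [mem_sigma, mem_range] at hx
    have : s + (r - s) = r := by omega
    simp only [this]
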